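/- Write $S_n$ for the symmetric group of $\{1,\dots,n\}$ ($n\ge 1$), $\tau_i=(i\ i{+}1)$, $1\le i\le n-1$, for its standard generators, and $[x,y]=xyx^{-1}y^{-1}$. Words in the $\tau_i$ are written as sequences of integers $i$; products are applied right to left. Consider the following algorithm, whose input is $n$ and a word $w$ of length $k$ in the $\tau_i$ representing an even permutation $\sigma\in A_n$. * **Main.** Read $w$; let $M=A(w)$, $d=B(M)$, $(c_1,c_2)=C(d,n)$; let $C_1$ and $C_2$ be the (single) cycles returned by $B(E(c_1))$ and $B(E(c_2))$; let $C_3$ be $C_1$ reversed and $\tau=D(C_3,C_2)$. Output $F(C_1)\,0\,F(\tau)\,0\,F(C_3)\,0\,F(\tau)^R\,00$, where $^R$ means reversal. * **A** turns a word into its permutation matrix $M$, stored as the array of the positions of the $1$ in each column: starting with the identity, for each letter $i$, read right to left, it swaps the columns with their $1$ in positions $i$ and $i+1$. * **B** returns the cycle decomposition (with $1$-cycles) of $M$, following each cycle from the first point not yet used. * **C**$(d,n)$, for a decomposition $d$ of an even permutation of $n$ points, returns two products of cycles: if $d$ is one cycle of odd length $n$, then $c_1=c_2=d^{(n+1)/2}$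 (a repeated cycle); if $d=(i_1 i_3\cdots i_{4m-1})(i_2 i_4\cdots i_{4m})$, then $c_1=c_2=(i_1 i_2\cdots i_{4m})$; if $d=(i_1 i_3\cdots i_{4s-1})(i_2 i_4\cdots i_{2s+2t}\, i_{4s+1} i_{4s+3}\cdots i_{2s+2t-1})$ with $s<t$ and cycle lengths $2s,2t$, then $c_1=(i_1\, i_{4s+1} i_{4s+2}\cdots i_{2s+2t}\, i_2 i_3\cdots i_{4s})$ and $c_2=(i_1 i_2\cdots i_{2s+2t})$; otherwise $d$ is split as $d_1d_2$, where $d_1$ is the first cycle of odd length, or the first two cycles if all lengths are even, and with $(c_{11},c_{12})$ and $(c_{21},c_{22})$ the pairs obtained from $d_1$ (by the preceding cases) and from $d_2$ (by recursion), and $u,v$ the largest points of $d_1,d_2$, it returns $c_1=c_{11}c_{21}(u\,v)$, $c_2=(u\,v)c_{12}c_{22}$. * **D**$(c_1,c_2)$, for two $n$-cycles written as sequences, returns the cycle decomposition of the permutation sending the $j$-th entry of $c_1$ to the $j$-th entry of $c_2$ for every $j$. * **E** turns a product of cycles into its permutation matrix: starting with the identity it moves the columns along each cycle, processing the cycles right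 to left, and finally inverts the result. * **F** turns a cycle decomposition into a word in the $\tau_i$, writing each cycle $(s\,d_1\cdots d_r)$ as $(s\,d_r)\cdots(s\,d_1)$ and each transposition $(t\,f)$, $t<f$, as $\tau_t\tau_{t+1}\cdots\tau_{f-1}\tau_{f-2}\cdots\tau_t$. Time is the number of pseudo-code statements executed: one unit for each assignment (of a number, or of a list already at hand, to a variable; or of an entry of an array), each read of an array entry, each arithmetic operation or test, each loop iteration, each subalgorithm call, and each symbol read from the input or written to the output; searches, counts, reversals, concatenations and repetitions are carried out by loops. **Proposition.** For every $n\ge1$ and every word $w$ in the standard generators of $S_n$ representing an even permutation $\sigma$, the algorithm terminates and outputs a string $x\,0\,y\,0\,x'\,0\,y'\,00$ of words in the standard generators such that $x'$ represents $x^{-1}$, $y'$ represents $y^{-1}$, and $\sigma=[x,y]$ in $S_n$. Moreover: 1. for every $k$ there are constants $c,n_0$ such that for all $n>n_0$ the algorithm runs in time at most $c\,n^2$ on every such word of length $k$ (time $O(n^2)$ for fixed $k$); 2. for every $n\ge1$ there are constants $c,k_0$ such that for all $k>k_0$ the algorithm runs in time at most $c\,k$ on every such word of length $k$ (time $O(k)$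 for fixed $n$). -/

import Mathlib

namespace CejtinRivin

/-! ## The symmetric group and words in its standard generators -/

/-- The standard generator `τ_i` of `S_n` (`1 ≤ i ≤ n - 1`): the transposition of the points `i` and
`i + 1` of `{1, …, n}`; the point `p` of `{1, …, n}` is the element `p - 1` of `Fin n`. -/
def gen (n i : ℕ) : Equiv.Perm (Fin n) :=
  if h : 1 ≤ i ∧ i < n then
    Equiv.swap ⟨i - 1, lt_of_le_of_lt (Nat.sub_le i 1) h.2⟩ ⟨i, h.2⟩
  else 1

/-- `w` is a word in the standard generators of `S_n`, the integer `i` standing for `τ_i`. -/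
def IsWord (n : ℕ) (w : List ℕ) : Prop := ∀ i ∈ w, 1 ≤ i ∧ i < n

/-- The permutation represented by a word (read left to right, applied right to left). -/
def wordPerm (n : ℕ) (w : List ℕ) : Equiv.Perm (Fin n) := (w.map (gen n)).prod

/-- `w` is an admissible input: a word in the standard generators that represents an even
permutation. -/
def IsEvenWord (n : ℕ) (w : List ℕ) : Prop :=
  IsWord n w ∧ wordPerm n w ∈ alternatingGroup (Fin n)

/-- The string `s` has the form `x 0 y 0 x' 0 y' 0 0` where `x, y, x', y'` are words in the standard
generators, `x'` represents the inverse of `x`, `y'` represents the inverse of `y`, and the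
permutation `σ` is the commutator `[x, y] = x y x⁻¹ y⁻¹`. -/
def IsCommutatorString (n : ℕ) (σ : Equiv.Perm (Fin n)) (s : List ℕ) : Prop :=
  ∃ x y x' y' : List ℕ,
    s = x ++ [0] ++ y ++ [0] ++ x' ++ [0] ++ y' ++ [0, 0] ∧
    IsWord n x ∧ IsWord n y ∧ IsWord n x' ∧ IsWord n y' ∧
    wordPerm n x' = (wordPerm n x)⁻¹ ∧ wordPerm n y' = (wordPerm n y)⁻¹ ∧
    σ = wordPerm n x * wordPerm n y * (wordPerm n x)⁻¹ * (wordPerm n y)⁻¹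

/-! ## Pseudo-code with a statement counter

A program is a possibly non-terminating computation that carries a counter of the pseudo-code
statements executed so far.  The counter is increased by `op` and `tick` only.  One unit is charged
for every elementary statement: an assignment of a value (a number, or a list already at hand or its
remainder after a fixed number of entries) to a variable or to an entry of an array (`l.set i v`, and
`l ++ [v]` for writing the first entry of `l` that is not yet in use), reading an entry of an array,
an arithmetic operation or a test, every iteration of a loop, every call of a subalgorithm, and every
symbol read from the input or written to the output.  Searches, counts, reversals, concatenations and
repetitions are written out as loops.

Variables are natural numbers and lists; a product of cycles is a list of cycles, and a cycle is the
list of its points. -/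

/-- Programs: the state is the number of statements executed, `none` is non-termination. -/
abbrev Prog (α : Type) : Type := StateT ℕ Option α

/-- Execute one statement whose result is `a`. -/
def op {α : Type} (a : α) : Prog α := fun t => some (a, t + 1)

/-- Execute one statement without result. -/
def tick : Prog Unit := op ()

/-- `Runs p a t`: the program `p` terminates with result `a` after executing exactly `t`
statements. -/
def Runs {α : Type} (p : Prog α) (a : α) (t : ℕ) : Prop := p 0 = some (a, t)

/-! ### Elementary loops -/

/-- Read or write a list, symbol by symbol. -/
def copy : List ℕ → Prog (List ℕ)
  | [] => op []
  | a :: l => do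
    tick
    let r ← copy l
    op (a :: r)

/-- The number of entries of a list. -/
def size {α : Type} : List α → Prog ℕ
  | [] => op 0
  | _ :: l => do
    tick
    let c ← size l
    op (c + 1)

/-- The reverse of the first list, followed by the second one. -/
def rev : List ℕ → List ℕ → Prog (List ℕ)
  | [], r => op r
  | a :: l, r => do
    tick
    let r ← op (a :: r)
    rev l r

/-- Concatenation of two lists. -/
def append {α : Type} : List α → List α → Prog (List α)
  | [], r => op r
  | a :: l, r => do
    tick
    let r ← append l r
    op (a :: r)

/-- Cut a list after its first `m` entries. -/
def cut : ℕ → List ℕ → Prog (List ℕ × List ℕ)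
  | 0, l => op ([], l)
  | _ + 1, [] => op ([], [])
  | m + 1, a :: l => do
    tick
    let (p, q) ← cut m l
    op (a :: p, q)

/-- The position (counting from `0`) of the first entry of a list that equals `v`. -/
def find (v : ℕ) : List ℕ → Prog ℕ
  | [] => op 0
  | a :: l => do
    tick
    if ← op (a == v) then
      op 0
    else
      let p ← find v l
      op (p + 1)

/-- The maximal entry of a list. -/
def maxOf : List ℕ → Prog ℕ
  | [] => op 0
  | a :: l => do
    tick
    let m ← maxOf l
    op (max a m)

/-- The maximal point that occurs in a list of cycles. -/
def maxOfCycles : List (List ℕ) → Prog ℕ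
  | [] => op 0
  | c :: d => do
    tick
    let a ← maxOf c
    let m ← maxOfCycles d
    op (max a m)

/-- An array of `m` zeros. -/
def zeros : ℕ → Prog (List ℕ)
  | 0 => op []
  | m + 1 => do
    tick
    let l ← zeros m
    op (0 :: l)

/-! ### Subalgorithm A: from a word to a permutation

The permutation matrix `M` of `σ` is stored as the array whose entry number `c` (counting from `1`) is
the position of the `1` in column `c`, that is, the point `σ(c)`. -/

/-- The identity matrix. -/
def identity : ℕ → Prog (List ℕ)
  | 0 => op []
  | m + 1 => do
    tick
    let M ← identity m
    op (M ++ [m + 1])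

/-- For each letter `i` of the word, reading right to left, exchange the column of `M` that has its
`1` in position `i` and the one that has its `1` in position `i + 1`. -/
def subALoop (M : List ℕ) : List ℕ → Prog (List ℕ)
  | [] => op M
  | i :: w => do
    tick
    let M ← subALoop M w
    let c₁ ← find i M
    let c₂ ← find (i + 1) M
    let M ← op (M.set c₁ (i + 1))
    op (M.set c₂ i)

def subA (n : ℕ) (w : List ℕ) : Prog (List ℕ) := do
  tick
  let M ← identity n
  subALoop M w

/-! ### Subalgorithm B: the cyclic decomposition of a permutation (including `1`-cycles)

The array `used` records which points have been written to `d`: its entry number `j` (counting from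
`1`) is `1` if `j` appears in the decomposition so far and `0` otherwise. -/

/-- The first point, counting from `j`, that is not marked in `used`; `0` if there is none. -/
def firstUnused : List ℕ → ℕ → Prog ℕ
  | [], _ => op 0
  | u :: l, j => do
    tick
    if ← op (u == 0) then
      op j
    else
      firstUnused l (j + 1)

/-- `d`: the cycles completed so far; `c`: the current cycle; `start`: its first point; `col`: its
last point so far. -/
def subBLoop (M : List ℕ) (used : List ℕ) (d : List (List ℕ)) (c : List ℕ) (start col : ℕ) :
    Prog (List (List ℕ)) := do
  let i ← op (M.getD (col - 1) 0)
  if ← op (i == start) then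
    let d ← op (d ++ [c])
    let start ← firstUnused used 1
    if ← op (start == 0) then
      op d
    else
      let used ← op (used.set (start - 1) 1)
      let c ← op [start]
      let col ← op start
      tick
      subBLoop M used d c start col
  else
    let c ← op (c ++ [i])
    let used ← op (used.set (i - 1) 1)
    let col ← op i
    tick
    subBLoop M used d c start col
  partial_fixpoint

def subB (n : ℕ) (M : List ℕ) : Prog (List (List ℕ)) := do
  tick
  let used ← zeros n
  let used ← op (used.set 0 1)
  let d ← op []
  let c ← op [1]
  let start ← op 1
  let col ← op 1
  subBLoop M used d c start col

/-! ### Subalgorithm C: an even permutation as a product of two `n`-cycles -/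

/-- The product `c c ⋯ c` with `m` factors. -/
def copies (c : List ℕ) : ℕ → Prog (List (List ℕ))
  | 0 => op []
  | m + 1 => do
    tick
    let l ← copies c m
    op (c :: l)

/-- The sequence `i₁ i₂ i₃ i₄ ⋯` from the sequences `i₁ i₃ ⋯` and `i₂ i₄ ⋯`. -/
def interleave : List ℕ → List ℕ → Prog (List ℕ)
  | a :: p, b :: q => do
    tick
    let r ← interleave p q
    op (a :: b :: r)
  | _, _ => op []

/-- For a product of two disjoint cycles `p = i₁ i₃ ⋯ i_{4m-1}` and `q = i₂ i₄ ⋯ i_{4m}`, the two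
(equal) factors `i₁ i₂ ⋯ i_{4m}`. -/
def equalPair (p q : List ℕ) : Prog (List (List ℕ) × List (List ℕ)) := do
  let c ← interleave p q
  let c₁ ← op [c]
  let c₂ ← op [c]
  op (c₁, c₂)

/-- For a product of two disjoint cycles `p = i₁ i₃ ⋯ i_{4s-1}` of length `a = 2s` and
`q = i₂ i₄ ⋯ i_{2s+2t} i_{4s+1} i_{4s+3} ⋯ i_{2s+2t-1}` of length `b = 2t`, where `s < t`, the factors
`i₁ i_{4s+1} i_{4s+2} ⋯ i_{2s+2t} i₂ i₃ ⋯ i_{4s}` and `i₁ i₂ i₃ ⋯ i_{2s+2t}`. -/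
def unequalPair (p q : List ℕ) (a b : ℕ) : Prog (List (List ℕ) × List (List ℕ)) := do
  let m ← op ((a + b) / 2)
  let (evens, rest) ← cut m q
  let odds ← append p rest
  let i ← interleave odds evens
  let (x, y) ← cut (2 * a) i
  let z ← append y x.tail
  let c₁ ← op [x.headD 0 :: z]
  let c₂ ← op [i]
  op (c₁, c₂)

/-- Find the first cycle of odd length; return it together with the list of the remaining cycles
(`none` if all cycles have even length). -/
def peelOdd : List (List ℕ) → Prog (Option (List ℕ × List (List ℕ)))
  | [] => op none
  | c :: d => do
    tick
    let k ← size c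
    if ← op (k % 2 == 1) then
      op (some (c, d))
    else
      let r ← peelOdd d
      match r with
      | none => op none
      | some (c', d') => op (some (c', c :: d'))

/-- The factors of a product of two disjoint even permutations with factors `c₁₁, c₁₂` and
`c₂₁, c₂₂`, joined by the transposition `(u v)`: `c₁ = c₁₁ c₂₁ (u v)` and `c₂ = (u v) c₁₂ c₂₂`. -/
def joinPairs (u v : ℕ) (c₁₁ c₁₂ c₂₁ c₂₂ : List (List ℕ)) :
    Prog (List (List ℕ) × List (List ℕ)) := do
  let e ← append c₂₁ [[u, v]]
  let c₁ ← append c₁₁ e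
  let f ← append c₁₂ c₂₂
  let c₂ ← op ([u, v] :: f)
  op (c₁, c₂)

/-- `d` is a decomposition into disjoint cycles of an even permutation of a set of `n` points. -/
def subC (d : List (List ℕ)) (n : ℕ) : Prog (List (List ℕ) × List (List ℕ)) := do
  tick
  let m ← size d
  let p ← op (d.getD 0 [])
  let q ← op (d.getD 1 [])
  let a ← size p
  let b ← size q
  if ← op (m == 1 && n % 2 == 1) then
    -- one cycle, of odd length
    let c ← copies p ((n + 1) / 2)
    op (c, c)
  else if ← op (m == 2 && a % 2 == 0 && a == b) then
    -- two cycles, of the same even length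
    equalPair p q
  else if ← op (m == 2 && a % 2 == 0 && b % 2 == 0) then
    -- two cycles, of different even lengths; the shorter one comes first
    if ← op (decide (a < b)) then
      unequalPair p q a b
    else
      unequalPair q p b a
  else
    let r ← peelOdd d
    match r with
    | some (d₁, d₂) =>
      -- peel off a cycle of odd length
      let k ← size d₁
      let c₁₁ ← copies d₁ ((k + 1) / 2)
      let c₁₂ ← op c₁₁
      let (c₂₁, c₂₂) ← subC d₂ (n - k)
      let u ← maxOf d₁
      let v ← maxOfCycles d₂
      joinPairs u v c₁₁ c₁₂ c₂₁ c₂₂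
    | none =>
      -- all cycles have even length: peel off two of them
      let e₁ ← op [p, q]
      let e₂ ← op (d.drop 2)
      let n' ← op (a + b)
      let (c₁₁, c₁₂) ← subC e₁ n'
      let (c₂₁, c₂₂) ← subC e₂ (n - n')
      let u ← maxOfCycles e₁
      let v ← maxOfCycles e₂
      joinPairs u v c₁₁ c₁₂ c₂₁ c₂₂
  partial_fixpoint

/-! ### Subalgorithm D: a permutation `τ` with `c₂ = τ c₁ τ⁻¹` for two `n`-cycles `c₁, c₂`

`τ` maps the entries of `c₁` to the entries of `c₂` in the same places; the output is its cyclic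
decomposition.  The array `used` marks the points written so far, as in subalgorithm B. -/

/-- The first place, counting from `i`, and the value there, of an entry that is not marked in
`used`; the value is `0` if there is none. -/
def firstUnusedIn (used : List ℕ) : List ℕ → ℕ → Prog (ℕ × ℕ)
  | [], i => op (i, 0)
  | a :: l, i => do
    tick
    if ← op (used.getD (a - 1) 0 == 0) then
      op (i, a)
    else
      firstUnusedIn used l (i + 1)

def subDLoop (c₁ c₂ : List ℕ) (used : List ℕ) (d : List (List ℕ)) (c : List ℕ) (start i : ℕ) :
    Prog (List (List ℕ)) := do
  let val ← op (c₂.getD i 0)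
  if ← op (val == start) then
    let d ← op (d ++ [c])
    let (i, start) ← firstUnusedIn used c₁ 0
    if ← op (start == 0) then
      op d
    else
      let used ← op (used.set (start - 1) 1)
      let c ← op [start]
      tick
      subDLoop c₁ c₂ used d c start i
  else
    let c ← op (c ++ [val])
    let used ← op (used.set (val - 1) 1)
    let i ← find val c₁
    tick
    subDLoop c₁ c₂ used d c start i
  partial_fixpoint

def subD (n : ℕ) (c₁ c₂ : List ℕ) : Prog (List (List ℕ)) := do
  tick
  let used ← zeros n
  let i ← op 0
  let start ← op (c₁.getD i 0)
  let used ← op (used.set (start - 1) 1)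
  let d ← op []
  let c ← op [start]
  subDLoop c₁ c₂ used d c start i

/-! ### Subalgorithm E: from a product of (not necessarily disjoint) cycles to a permutation -/

/-- Move the columns of `M` along a cycle with first point `s`: each column is overwritten by the
preceding one, `prev` holding the old content of the preceding column. -/
def subECycle (M : List ℕ) (s prev : ℕ) : List ℕ → Prog (List ℕ)
  | [] => op (M.set (s - 1) prev)
  | j :: l => do
    tick
    let next ← op (M.getD (j - 1) 0)
    let M ← op (M.set (j - 1) prev)
    subECycle M s next l

/-- Process the cycles, reading right to left. -/
def subELoop (M : List ℕ) : List (List ℕ) → Prog (List ℕ)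
  | [] => op M
  | c :: S => do
    tick
    let M ← subELoop M S
    let s ← op (c.headD 0)
    let prev ← op (M.getD (s - 1) 0)
    subECycle M s prev c.tail

/-- The array whose entry number `k ≤ m` is the number of the column of `M` in which `1` appears in
position `k`. -/
def subEInvert (M : List ℕ) : ℕ → Prog (List ℕ)
  | 0 => op []
  | m + 1 => do
    tick
    let T ← subEInvert M m
    let p ← find (m + 1) M
    op (T ++ [p + 1])

def subE (n : ℕ) (S : List (List ℕ)) : Prog (List ℕ) := do
  tick
  let M ← identity n
  let M ← subELoop M S
  subEInvert M n

/-! ### Subalgorithm F: from a cyclic decomposition to a word in the standard generators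

A cycle `s d₁ d₂ ⋯ d_r` is `(s d_r) ⋯ (s d₂)(s d₁)`, applied right to left, and the transposition
`(t f)` with `t < f` is `τ_t τ_{t+1} ⋯ τ_{f-1} τ_{f-2} ⋯ τ_t`.  The word `w` collects these letters,
starting with the transposition that is applied first; the output is the reverse of `w`. -/

/-- While `t < f`, write `t` to `w` and increase `t`, counting the letters in `c`. -/
def subFUp (w : List ℕ) (c t f : ℕ) : Prog (List ℕ × ℕ) := do
  if ← op (decide (t < f)) then
    let w ← op (w ++ [t])
    let c ← op (c + 1)
    let t ← op (t + 1)
    subFUp w c t f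
  else
    op (w, c)
  partial_fixpoint

/-- Write the letters of `w` at the places `a + c - 1, …, a + 1, a` to `w`. -/
def subFDown (w : List ℕ) (a : ℕ) : ℕ → Prog (List ℕ)
  | 0 => op w
  | c + 1 => do
    tick
    let w ← op (w ++ [w.getD (a + c) 0])
    subFDown w a c

/-- Write the transposition of the points `s` and `e`. -/
def subFSwap (w : List ℕ) (s e : ℕ) : Prog (List ℕ) := do
  let a ← op w.length
  let f ← op (max s e)
  let t ← op (min s e)
  let (w, c) ← subFUp w 0 t f
  let c ← op (c - 1)
  subFDown w a c

/-- Write the cycle with first point `s` and the given further points. -/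
def subFCycle (w : List ℕ) (s : ℕ) : List ℕ → Prog (List ℕ)
  | [] => op w
  | e :: l => do
    tick
    let w ← subFSwap w s e
    subFCycle w s l

def subFLoop (w : List ℕ) : List (List ℕ) → Prog (List ℕ)
  | [] => op w
  | c :: d => do
    tick
    let s ← op (c.headD 0)
    let w ← subFCycle w s c.tail
    subFLoop w d

def subF (d : List (List ℕ)) : Prog (List ℕ) := do
  tick
  let w ← op []
  let w ← subFLoop w d
  rev w []

/-! ### The main algorithm -/

/-- On input `n` and a word `w` in the standard generators of `S_n` that represents an even
permutation `σ`, write `σ` as `C₁ C₂` with `n`-cycles `C₁, C₂`, find `τ` with `C₂ = τ C₁⁻¹ τ⁻¹`, and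
output words for `C₁`, `τ`, `C₁⁻¹`, `τ⁻¹`, separated by `0` and terminated by `00`. -/
def cejtinRivin (n : ℕ) (w : List ℕ) : Prog (List ℕ) := do
  let w ← copy w
  let M ← subA n w
  let d ← subB n M
  let (c₁, c₂) ← subC d n
  let S ← subE n c₁
  let T ← subE n c₂
  let D₁ ← subB n S
  let D₂ ← subB n T
  let C₁ ← op (D₁.headD [])
  let C₂ ← op (D₂.headD [])
  let C₃ ← rev C₁ []
  let τ ← subD n C₃ C₂
  let x ← subF [C₁]
  let y ← subF τ
  let x' ← subF [C₃]
  let y' ← rev y []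
  copy (x ++ [0] ++ y ++ [0] ++ x' ++ [0] ++ y' ++ [0, 0])

end CejtinRivin

/-! The algorithm writes an even permutation `σ` as a commutator because an even permutation of
`n` points is a product of two `n`-cycles: if `σ = C₁ C₂`, then `C₁⁻¹` and `C₂` are conjugate, and
`C₂ = τ C₁⁻¹ τ⁻¹` gives `σ = C₁ τ C₁⁻¹ τ⁻¹`.

All computations take place in the permutations of `ℕ` that fix everything outside `{1, …, n}`
(`permsUpTo`), where a list of points denotes the cycle `List.formPerm`; the passage to `Fin n`
(`toNat`) is needed only for the parity of `σ` and for reading off the final identity.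

The factorization (`subCFactors`) is an induction on the number of cycles. A cycle of odd length
has a square root on the same points (`exists_formPerm_eq_pow`). A product of two disjoint cycles
of even length is the square of a single cycle if the lengths agree
(`formPerm_interleaved_mul_self`), and otherwise the product of that cycle with one in which a
block of points has been moved (`formPerm_movedBlock_mul`). Two disjoint factorizations are joined
by a transposition `(u v)`, which merges two disjoint cycles into one and cancels in the product
`c₁ c₂` (`IsFactor.join`). Parity guarantees that one of the cases always applies: a decomposition
without odd cycles has an even number of members.

Subalgorithms B and D both trace the cycles of a permutation, reading its values in different
ways; `Tracing` is their common invariant. The cycle decomposition of an `n`-cycle can only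
consist of that cycle (`IsDecomp.eq_singleton`), so that B recovers `C₁` and `C₂`.

For the time, `Computes p a T` bounds the number of statements of `p` by `T` independently of the
initial counter, which makes bounds additive along a program. Every subalgorithm except A takes
time `O(n ^ 2)`, and A takes time `O(n k)` beyond `O(n)`; hence the single bound
`1000 (n ^ 2 + n k)` of `exists_runs_cejtinRivin`, with `k` the length of the input, yields both
asymptotic statements. In subalgorithm C the recursion is quadratic, and so is the total length of the
factors that it returns, because `a ^ 2 + b ^ 2 + (a + b) ≤ (a + b) ^ 2` for positive `a` and `b`.
-/

namespace CejtinRivin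

open Equiv (Perm swap)

/-! ### Running time -/

/-- The program `p` terminates with result `a` after at most `T` statements, from every state of the
counter. -/
def Computes {α : Type} (p : Prog α) (a : α) (T : ℕ) : Prop :=
  ∀ t, ∃ s ≤ T, p t = some (a, t + s)

namespace Computes

variable {α β : Type}

theorem runs {p : Prog α} {a : α} {T : ℕ} (h : Computes p a T) : ∃ t ≤ T, Runs p a t := by
  obtain ⟨s, hs, h⟩ := h 0
  exact ⟨s, hs, by simpa [Runs] using h⟩

theorem mono {p : Prog α} {a : α} {T T' : ℕ} (h : Computes p a T) (hT : T ≤ T') :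
    Computes p a T' := fun t =>
  let ⟨s, hs, h⟩ := h t
  ⟨s, hs.trans hT, h⟩

theorem op (a : α) : Computes (op a) a 1 := fun _ => ⟨1, le_rfl, rfl⟩

theorem bind {p : Prog α} {f : α → Prog β} {a : α} {b : β} {T T' : ℕ} (hp : Computes p a T)
    (hf : Computes (f a) b T') : Computes (p >>= f) b (T + T') := by
  intro t
  obtain ⟨s, hs, h⟩ := hp t
  obtain ⟨s', hs', h'⟩ := hf (t + s)
  refine ⟨s + s', by omega, ?_⟩
  change (p t >>= fun x => f x.1 x.2) = _
  rw [h]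
  change f a (t + s) = _
  rw [h', add_assoc]

theorem op_bind {f : α → Prog β} {a : α} {b : β} {T : ℕ} (hf : Computes (f a) b T) :
    Computes (CejtinRivin.op a >>= f) b (T + 1) :=
  ((op a).bind hf).mono (by omega)

theorem tick_bind {p : Prog β} {b : β} {T : ℕ} (hf : Computes p b T) :
    Computes (do tick; p) b (T + 1) :=
  op_bind (a := ()) (f := fun _ => p) hf

/-- A test that succeeds. -/
theorem test_true {x : Bool} {p q : Prog β} {b : β} {T : ℕ} (hx : x = true)
    (hp : Computes p b T) : Computes (do if ← CejtinRivin.op x then p else q) b (T + 1) :=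
  op_bind (by simpa [hx] using hp)

/-- A test that fails. -/
theorem test_false {x : Bool} {p q : Prog β} {b : β} {T : ℕ} (hx : x = false)
    (hq : Computes q b T) : Computes (do if ← CejtinRivin.op x then p else q) b (T + 1) :=
  op_bind (by simpa [hx] using hq)

end Computes

/-! ### Elementary loops -/

theorem computes_copy (l : List ℕ) : Computes (copy l) l (2 * l.length + 1) := by
  induction l with
  | nil => exact .op _
  | cons a l ih =>
    refine .mono (Computes.tick_bind (ih.bind (.op _))) ?_
    simp only [List.length_cons]
    omega

theorem computes_size {α : Type} (l : List α) : Computes (size l) l.length (2 * l.length + 1) := by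
  induction l with
  | nil => exact .op _
  | cons a l ih =>
    refine .mono (Computes.tick_bind (ih.bind (.op _))) ?_
    simp only [List.length_cons]
    omega

theorem computes_rev (l r : List ℕ) :
    Computes (rev l r) (l.reverse ++ r) (2 * l.length + 1) := by
  induction l generalizing r with
  | nil => exact .op _
  | cons a l ih =>
    have := ih (a :: r)
    rw [List.reverse_cons, List.append_assoc]
    refine .mono (Computes.tick_bind (Computes.op_bind this)) ?_
    simp only [List.length_cons]
    omega

theorem computes_append {α : Type} (l r : List α) :
    Computes (append l r) (l ++ r) (2 * l.length + 1) := by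
  induction l with
  | nil => exact .op _
  | cons a l ih =>
    refine .mono (Computes.tick_bind (ih.bind (.op _))) ?_
    simp only [List.length_cons]
    omega

theorem computes_cut (m : ℕ) (l : List ℕ) :
    Computes (cut m l) (l.take m, l.drop m) (2 * m + 1) := by
  induction l generalizing m with
  | nil =>
    cases m
    · exact .op _
    · exact (Computes.op _).mono (by omega)
  | cons a l ih =>
    cases m with
    | zero => exact .op _
    | succ m => 
      refine .mono (Computes.tick_bind ((ih m).bind (.op _))) ?_
      omega

theorem computes_find (v : ℕ) (l : List ℕ) :
    Computes (find v l) (l.idxOf v) (3 * l.length + 1) := by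
  induction l with
  | nil => exact .op _
  | cons a l ih =>
    by_cases h : a = v
    · rw [List.idxOf_cons_eq _ h]
      refine .mono (Computes.tick_bind (Computes.test_true (by simpa using h) (.op _))) ?_
      simp only [List.length_cons]
      omega
    · rw [List.idxOf_cons_ne _ h]
      refine .mono (Computes.tick_bind (Computes.test_false (by simp [h]) (ih.bind (.op _)))) ?_
      simp only [List.length_cons]
      omega

theorem computes_zeros (m : ℕ) : Computes (zeros m) (List.replicate m 0) (2 * m + 1) := by
  induction m with
  | zero => exact .op _
  | succ m ih => 
    refine .mono (Computes.tick_bind (ih.bind (.op _))) ?_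
    omega

theorem computes_copies (c : List ℕ) (m : ℕ) :
    Computes (copies c m) (List.replicate m c) (2 * m + 1) := by
  induction m with
  | zero => exact .op _
  | succ m ih => 
    refine .mono (Computes.tick_bind (ih.bind (.op _))) ?_
    omega

theorem computes_maxOf (l : List ℕ) :
    Computes (maxOf l) (l.foldr max 0) (2 * l.length + 1) := by
  induction l with
  | nil => exact .op _
  | cons a l ih =>
    refine .mono (Computes.tick_bind (ih.bind (.op _))) ?_
    simp only [List.length_cons]
    omega

theorem computes_maxOfCycles (d : List (List ℕ)) :
    Computes (maxOfCycles d) (d.flatten.foldr max 0) (2 * d.flatten.length + 3 * d.length + 1) := by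
  induction d with
  | nil => exact .op _
  | cons c d ih =>
    have h : (c :: d).flatten.foldr max 0 = max (c.foldr max 0) (d.flatten.foldr max 0) := by
      induction c with
      | nil => simp
      | cons a c ihc =>
        simp only [List.flatten_cons, List.cons_append, List.foldr_cons] at ihc ⊢
        rw [ihc, max_assoc]
    rw [h]
    refine .mono (Computes.tick_bind ((computes_maxOf c).bind (ih.bind (.op _)))) ?_
    simp only [List.length_cons, List.flatten_cons, List.length_append]
    omega

/-- The start value `0` of the maximum is not returned for a nonempty list, unless it is an entry. -/
theorem foldr_max_mem {l : List ℕ} (hl : l ≠ []) : l.foldr max 0 ∈ l := by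
  induction l with
  | nil => exact absurd rfl hl
  | cons a l ih =>
    rw [List.foldr_cons]
    rcases eq_or_ne l [] with rfl | h
    · simp
    · rcases max_choice a (l.foldr max 0) with h' | h' <;> rw [h']
      · exact List.mem_cons_self
      · exact List.mem_cons_of_mem _ (ih h)

/-- The sequence `i₁ i₂ i₃ i₄ ⋯` from the sequences `i₁ i₃ ⋯` and `i₂ i₄ ⋯`. -/
def interleaved : List ℕ → List ℕ → List ℕ
  | a :: p, b :: q => a :: b :: interleaved p q
  | _, _ => []

theorem computes_interleave (p q : List ℕ) :
    Computes (interleave p q) (interleaved p q) (2 * p.length + 1) := by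
  induction p generalizing q with
  | nil => simpa [interleave, interleaved] using Computes.op _
  | cons a p ih =>
    cases q with
    | nil => exact (Computes.op _).mono (by omega)
    | cons b q =>
      refine .mono (Computes.tick_bind ((ih q).bind (.op _))) ?_
      simp only [List.length_cons]
      omega

theorem length_interleaved {p q : List ℕ} (h : p.length = q.length) :
    (interleaved p q).length = 2 * p.length := by
  induction p generalizing q with
  | nil => simp [interleaved]
  | cons a p ih =>
    cases q with
    | nil => simp at h
    | cons b q =>
      simp only [List.length_cons, add_left_inj] at h
      simp only [interleaved, List.length_cons, ih h]
      omega

theorem interleaved_perm {p q : List ℕ} (h : p.length = q.length) :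
    (interleaved p q).Perm (p ++ q) := by
  induction p generalizing q with
  | nil =>
    rw [List.eq_nil_of_length_eq_zero (l := q) (by simpa using h.symm)]
    simp [interleaved]
  | cons a p ih =>
    cases q with
    | nil => simp at h
    | cons b q =>
      simp only [List.length_cons, add_left_inj] at h
      simp only [interleaved, List.cons_append]
      exact (((ih h).cons b).trans List.perm_middle.symm).cons a

theorem interleaved_getD_even {p q : List ℕ} (h : p.length = q.length) (j : ℕ) :
    (interleaved p q).getD (2 * j) 0 = p.getD j 0 := by
  induction p generalizing q j with
  | nil => simp [interleaved]
  | cons a p ih =>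
    cases q with
    | nil => simp at h
    | cons b q =>
      simp only [List.length_cons, add_left_inj] at h
      cases j with
      | zero => simp [interleaved]
      | succ j => simpa [interleaved, Nat.mul_succ] using ih h j

theorem interleaved_getD_odd {p q : List ℕ} (h : p.length = q.length) (j : ℕ) :
    (interleaved p q).getD (2 * j + 1) 0 = q.getD j 0 := by
  induction p generalizing q j with
  | nil =>
    rw [List.eq_nil_of_length_eq_zero (l := q) (by simpa using h.symm)]
    simp [interleaved]
  | cons a p ih =>
    cases q with
    | nil => simp at h
    | cons b q =>
      simp only [List.length_cons, add_left_inj] at h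
      cases j with
      | zero => simp [interleaved]
      | succ j => simpa [interleaved, Nat.mul_succ] using ih h j

/-! ### Permutations of `{1, …, n}` and arrays -/

/-- The permutations of `{1, …, n}`, as the permutations of `ℕ` that fix all other numbers. -/
def permsUpTo (n : ℕ) : Subgroup (Perm ℕ) where
  carrier := {π | ∀ x, ¬ (1 ≤ x ∧ x ≤ n) → π x = x}
  mul_mem' := fun {π ρ} hπ hρ x hx => by rw [Perm.mul_apply, hρ x hx, hπ x hx]
  one_mem' := fun _ _ => rfl
  inv_mem' := fun {π} hπ x hx => by rw [Perm.inv_eq_iff_eq, hπ x hx]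

theorem apply_mem_range {n : ℕ} {π : Perm ℕ} (hπ : π ∈ permsUpTo n) {x : ℕ}
    (hx : 1 ≤ x ∧ x ≤ n) : 1 ≤ π x ∧ π x ≤ n := by
  by_contra h
  have := π.injective (hπ _ h)
  rw [this] at h
  exact h hx

theorem swap_mem_permsUpTo {n a b : ℕ} (ha : 1 ≤ a ∧ a ≤ n) (hb : 1 ≤ b ∧ b ≤ n) :
    swap a b ∈ permsUpTo n := fun _ hx =>
  Equiv.swap_apply_of_ne_of_ne (fun h => hx (h ▸ ha)) (fun h => hx (h ▸ hb))

theorem formPerm_mem_permsUpTo {n : ℕ} {c : List ℕ} (hc : ∀ x ∈ c, 1 ≤ x ∧ x ≤ n) :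
    c.formPerm ∈ permsUpTo n := fun _ hx =>
  List.formPerm_apply_of_notMem fun h => hx (hc _ h)

/-- The array with entries `f 1, …, f n`. -/
def table (n : ℕ) (f : ℕ → ℕ) : List ℕ := (List.range n).map fun i => f (i + 1)

@[simp] theorem length_table (n : ℕ) (f : ℕ → ℕ) : (table n f).length = n := by simp [table]

theorem table_succ (n : ℕ) (f : ℕ → ℕ) : table (n + 1) f = table n f ++ [f (n + 1)] := by
  simp [table, List.range_succ]

theorem getElem_table {n : ℕ} (f : ℕ → ℕ) {i : ℕ} (h : i < (table n f).length) :
    (table n f)[i] = f (i + 1) := by simp [table]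

theorem table_getD {n : ℕ} (f : ℕ → ℕ) {x : ℕ} (hx : 1 ≤ x ∧ x ≤ n) :
    (table n f).getD (x - 1) 0 = f x := by
  rw [List.getD_eq_getElem _ _ (by rw [length_table]; omega), getElem_table,
    Nat.sub_add_cancel hx.1]

theorem table_set (n : ℕ) (f : ℕ → ℕ) {x : ℕ} (hx : 1 ≤ x) (v : ℕ) :
    (table n f).set (x - 1) v = table n (Function.update f x v) := by
  apply List.ext_getElem
  · simp
  · intro i h₁ h₂
    rw [List.getElem_set, getElem_table, getElem_table]
    by_cases h : x - 1 = i
    · rw [if_pos h, show i + 1 = x by omega, Function.update_self]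
    · rw [if_neg h, Function.update_of_ne (by omega)]

theorem table_congr {n : ℕ} {f g : ℕ → ℕ} (h : ∀ x, 1 ≤ x ∧ x ≤ n → f x = g x) :
    table n f = table n g := by
  apply List.map_congr_left
  intro i hi
  exact h _ ⟨by omega, by simpa using hi⟩

theorem nodup_table (n : ℕ) (π : Perm ℕ) : (table n π).Nodup := by
  refine List.Nodup.map ?_ List.nodup_range
  intro i j h
  simpa using h

/-- In the array of a permutation, `v` stands in the place of its preimage. -/
theorem idxOf_table {n : ℕ} {π : Perm ℕ} (hπ : π ∈ permsUpTo n) {v : ℕ} (hv : 1 ≤ v ∧ v ≤ n) :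
    (table n π).idxOf v + 1 = π⁻¹ v := by
  have h := apply_mem_range (inv_mem hπ) hv
  have hlt : π⁻¹ v - 1 < (table n π).length := by rw [length_table]; omega
  have hget : (table n π)[π⁻¹ v - 1] = v := by
    rw [getElem_table, Nat.sub_add_cancel h.1]
    simp
  have := (nodup_table n π).idxOf_getElem _ hlt
  rw [hget] at this
  omega

/-! ### Subalgorithm A -/

theorem computes_identity (m : ℕ) : Computes (identity m) (table m (1 : Perm ℕ)) (2 * m + 1) := by
  induction m with
  | zero => exact .op _
  | succ m ih =>
    rw [table_succ]
    refine .mono (Computes.tick_bind (ih.bind (.op _))) ?_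
    omega

/-- The permutation of `ℕ` represented by a word. -/
def natPerm (w : List ℕ) : Perm ℕ := (w.map fun i => swap i (i + 1)).prod

@[simp] theorem natPerm_nil : natPerm [] = 1 := rfl

@[simp] theorem natPerm_cons (i : ℕ) (w : List ℕ) :
    natPerm (i :: w) = swap i (i + 1) * natPerm w := by simp [natPerm]

@[simp] theorem natPerm_append (v w : List ℕ) : natPerm (v ++ w) = natPerm v * natPerm w := by
  simp [natPerm]

theorem natPerm_reverse (w : List ℕ) : natPerm w.reverse = (natPerm w)⁻¹ := by
  induction w with
  | nil => simp
  | cons i w ih => simp [ih]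

theorem natPerm_mem {n : ℕ} {w : List ℕ} (hw : IsWord n w) : natPerm w ∈ permsUpTo n := by
  induction w with
  | nil => exact one_mem _
  | cons i w ih =>
    rw [natPerm_cons]
    have := hw i List.mem_cons_self
    exact mul_mem (swap_mem_permsUpTo (by omega) (by omega))
      (ih fun j hj => hw j (List.mem_cons_of_mem _ hj))

/-- Exchanging two columns multiplies the permutation by a standard generator. -/
theorem table_swap {n : ℕ} {π : Perm ℕ} (hπ : π ∈ permsUpTo n) {i : ℕ} (hi : 1 ≤ i ∧ i < n) :
    ((table n π).set ((table n π).idxOf i) (i + 1)).set ((table n π).idxOf (i + 1)) i =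
      table n (swap i (i + 1) * π : Perm ℕ) := by
  have h₁ := idxOf_table hπ (v := i) (by omega)
  have h₂ := idxOf_table hπ (v := i + 1) (by omega)
  rw [show (table n π).idxOf i = π⁻¹ i - 1 by omega,
    show (table n π).idxOf (i + 1) = π⁻¹ (i + 1) - 1 by omega,
    table_set _ _ (by omega), table_set _ _ (by omega)]
  refine table_congr fun x _ => ?_
  simp only [Function.update_apply, Perm.mul_apply, Perm.eq_inv_iff_eq]
  by_cases hx : π x = i + 1
  · rw [if_pos hx, hx, Equiv.swap_apply_right]
  · rw [if_neg hx]
    by_cases hx' : π x = i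
    · rw [if_pos hx', hx', Equiv.swap_apply_left]
    · rw [if_neg hx', Equiv.swap_apply_of_ne_of_ne hx' hx]

theorem computes_subALoop {n : ℕ} {w : List ℕ} (hw : IsWord n w) :
    Computes (subALoop (table n (1 : Perm ℕ)) w) (table n (natPerm w))
      (w.length * (6 * n + 5) + 1) := by
  induction w with
  | nil => exact .mono (.op _) (by omega)
  | cons i w ih =>
    have hw' : IsWord n w := fun j hj => hw j (List.mem_cons_of_mem _ hj)
    have hi := hw i List.mem_cons_self
    rw [natPerm_cons, ← table_swap (natPerm_mem hw') hi]
    refine .mono (Computes.tick_bind ((ih hw').bind ((computes_find _ _).bind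
      ((computes_find _ _).bind (Computes.op_bind (.op _)))))) ?_
    simp only [length_table, List.length_cons, add_mul]
    omega

theorem computes_subA {n : ℕ} {w : List ℕ} (hw : IsWord n w) :
    Computes (subA n w) (table n (natPerm w)) (2 * n + w.length * (6 * n + 5) + 3) := by
  refine .mono (Computes.tick_bind ((computes_identity n).bind (computes_subALoop hw))) ?_
  omega

/-! ### Cycles -/

theorem formPerm_map (σ : Perm ℕ) (c : List ℕ) :
    (c.map σ).formPerm = σ * c.formPerm * σ⁻¹ := by
  induction c with
  | nil => simp
  | cons a c ih =>
    cases c with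
    | nil => simp
    | cons b c =>
      simp only [List.map_cons, List.formPerm_cons_cons] at ih ⊢
      rw [ih, Equiv.swap_apply_apply]
      group

/-- A cycle is multiplied on the right by the transposition of its first two points. -/
theorem formPerm_cons_cons_right {a b : ℕ} {c : List ℕ} (h : (a :: b :: c).Nodup) :
    (a :: b :: c).formPerm = (a :: c).formPerm * swap a b := by
  have hm : (b :: c).map (swap a b) = a :: c := by
    simp only [List.nodup_cons, List.mem_cons, not_or] at h
    rw [List.map_cons, Equiv.swap_apply_right]
    congr 1
    refine (List.map_congr_left fun x hx => ?_).trans (List.map_id _)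
    exact Equiv.swap_apply_of_ne_of_ne (fun e => h.1.2 (e ▸ hx)) (fun e => h.2.1 (e ▸ hx))
  rw [← hm, formPerm_map, Equiv.swap_inv, List.formPerm_cons_cons]
  simp [mul_assoc]

/-- The product of a list of cycles. -/
def cyclesProd (d : List (List ℕ)) : Perm ℕ := (d.map List.formPerm).prod

@[simp] theorem cyclesProd_nil : cyclesProd [] = 1 := rfl

@[simp] theorem cyclesProd_cons (c : List ℕ) (d : List (List ℕ)) :
    cyclesProd (c :: d) = c.formPerm * cyclesProd d := by simp [cyclesProd]

@[simp] theorem cyclesProd_append (d e : List (List ℕ)) :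
    cyclesProd (d ++ e) = cyclesProd d * cyclesProd e := by simp [cyclesProd]

/-- The lists in `d` are the sequences of points of (not necessarily disjoint) cycles in
`{1, …, n}`. -/
def AreCycles (n : ℕ) (d : List (List ℕ)) : Prop :=
  ∀ c ∈ d, c ≠ [] ∧ c.Nodup ∧ ∀ x ∈ c, 1 ≤ x ∧ x ≤ n

theorem cyclesProd_mem {n : ℕ} {d : List (List ℕ)} (hd : AreCycles n d) :
    cyclesProd d ∈ permsUpTo n := by
  refine list_prod_mem fun π hπ => ?_
  obtain ⟨c, hc, rfl⟩ := List.mem_map.1 hπ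
  exact formPerm_mem_permsUpTo (hd c hc).2.2

/-! ### Subalgorithm E -/

/-- Moving the columns along a cycle composes the array with the inverse of that cycle, except that
the old content of the first column is replaced by `prev`. -/
theorem computes_subECycle {n : ℕ} (f : ℕ → ℕ) {s : ℕ} (prev : ℕ) {l : List ℕ}
    (hl : (s :: l).Nodup) (hr : ∀ x ∈ s :: l, 1 ≤ x ∧ x ≤ n) :
    Computes (subECycle (table n f) s prev l)
      (table n (Function.update f s prev ∘ ⇑((s :: l).formPerm)⁻¹)) (3 * l.length + 1) := by
  induction l generalizing f prev with
  | nil =>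
    have hs := hr s List.mem_cons_self
    have : Function.update f s prev ∘ ⇑(([s] : List ℕ).formPerm)⁻¹ = Function.update f s prev := by
      simp
    rw [this, ← table_set _ _ hs.1]
    exact .op _
  | cons j l ih =>
    have hj := hr j (by simp)
    have hsj : s ≠ j := fun e => by simp [e] at hl
    have key : Function.update f s prev ∘ ⇑((s :: j :: l).formPerm)⁻¹ =
        Function.update (Function.update f j prev) s (f j) ∘ ⇑((s :: l).formPerm)⁻¹ := by
      rw [formPerm_cons_cons_right hl, mul_inv_rev, Equiv.swap_inv, Perm.coe_mul,
        ← Function.comp_assoc]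
      congr 1
      funext x
      simp only [Function.comp_apply, Function.update_apply]
      rcases eq_or_ne x s with rfl | hx
      · simp [hsj.symm]
      · rcases eq_or_ne x j with rfl | hx'
        · simp [hsj.symm]
        · simp [Equiv.swap_apply_of_ne_of_ne hx hx', hx, hx']
    have hl' : (s :: l).Nodup := hl.sublist (by simp)
    have hr' : ∀ x ∈ s :: l, 1 ≤ x ∧ x ≤ n := fun x hx => hr x (by
      rcases List.mem_cons.1 hx with rfl | hx <;> simp [*])
    have := ih (Function.update f j prev) (f j) hl' hr'
    rw [key]
    rw [← table_set _ _ hj.1, ← table_getD f hj] at this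
    rw [← table_getD f hj]
    refine .mono (Computes.tick_bind (Computes.op_bind (Computes.op_bind this))) ?_
    simp only [List.length_cons]
    omega

theorem computes_subELoop {n : ℕ} {d : List (List ℕ)} (hd : AreCycles n d) :
    Computes (subELoop (table n (1 : Perm ℕ)) d) (table n ⇑(cyclesProd d)⁻¹)
      (3 * d.flatten.length + 4 * d.length + 1) := by
  induction d with
  | nil =>
    have : (⇑(cyclesProd [])⁻¹ : ℕ → ℕ) = (1 : Perm ℕ) := by simp
    rw [this]
    exact .mono (.op _) (by simp)
  | cons c d ih =>
    have hd' : AreCycles n d := fun c' hc' => hd c' (List.mem_cons_of_mem _ hc')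
    obtain ⟨hne, hnd, hr⟩ := hd c List.mem_cons_self
    obtain ⟨s, l, rfl⟩ := List.exists_cons_of_ne_nil hne
    have hs := hr s List.mem_cons_self
    have h := computes_subECycle (n := n) ⇑(cyclesProd d)⁻¹ ((cyclesProd d)⁻¹ s) hnd hr
    rw [Function.update_eq_self, ← table_getD ⇑(cyclesProd d)⁻¹ hs, ← Perm.coe_mul, ← mul_inv_rev,
      ← cyclesProd_cons] at h
    refine .mono (Computes.tick_bind ((ih hd').bind (Computes.op_bind (Computes.op_bind h)))) ?_
    simp only [List.flatten_cons, List.length_append, List.length_cons]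
    omega

theorem computes_subEInvert {n : ℕ} {π : Perm ℕ} (hπ : π ∈ permsUpTo n) {m : ℕ} (hm : m ≤ n) :
    Computes (subEInvert (table n π) m) (table m ⇑π⁻¹) (m * (3 * n + 3) + 1) := by
  induction m with
  | zero => exact .mono (.op _) (by omega)
  | succ m ih =>
    rw [table_succ, ← idxOf_table hπ (by omega)]
    refine .mono (Computes.tick_bind ((ih (by omega)).bind ((computes_find _ _).bind (.op _)))) ?_
    simp only [length_table, add_mul]
    omega

theorem computes_subE {n : ℕ} {d : List (List ℕ)} (hd : AreCycles n d) :
    Computes (subE n d) (table n (cyclesProd d))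
      (n * (3 * n + 5) + 3 * d.flatten.length + 4 * d.length + 4) := by
  have h := computes_subEInvert (inv_mem (cyclesProd_mem hd)) le_rfl
  rw [inv_inv] at h
  refine .mono (Computes.tick_bind ((computes_identity n).bind ((computes_subELoop hd).bind h))) ?_
  simp only [mul_add]
  omega

/-! ### Orbits and cycle decompositions -/

/-- The points `s, π s, …, π ^ (m - 1) s`. -/
def orbitList (π : Perm ℕ) (s m : ℕ) : List ℕ := (List.range m).map fun j => (π ^ j) s

@[simp] theorem length_orbitList (π : Perm ℕ) (s m : ℕ) : (orbitList π s m).length = m := by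
  simp [orbitList]

theorem getElem_orbitList (π : Perm ℕ) (s m : ℕ) {j : ℕ} (h : j < (orbitList π s m).length) :
    (orbitList π s m)[j] = (π ^ j) s := by simp [orbitList]

theorem orbitList_succ (π : Perm ℕ) (s m : ℕ) :
    orbitList π s (m + 1) = orbitList π s m ++ [(π ^ m) s] := by
  simp [orbitList, List.range_succ]

theorem mem_orbitList {π : Perm ℕ} {s m x : ℕ} :
    x ∈ orbitList π s m ↔ ∃ j < m, (π ^ j) s = x := by simp [orbitList]

/-- An orbit that closes up after `m` distinct points is a cycle of the permutation. -/
theorem apply_eq_formPerm_orbitList {π : Perm ℕ} {s m : ℕ} (hnd : (orbitList π s m).Nodup)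
    (hm : (π ^ m) s = s) {x : ℕ} (hx : x ∈ orbitList π s m) :
    π x = (orbitList π s m).formPerm x := by
  obtain ⟨j, hj, rfl⟩ := mem_orbitList.1 hx
  have hj' : j < (orbitList π s m).length := by simpa
  have h := List.formPerm_apply_getElem _ hnd j hj'
  simp only [getElem_orbitList, length_orbitList] at h
  rw [h, ← Perm.mul_apply, ← pow_succ']
  rcases Nat.lt_or_ge (j + 1) m with h' | h'
  · rw [Nat.mod_eq_of_lt h']
  · rw [show j + 1 = m by omega, Nat.mod_self, hm, pow_zero, Perm.one_apply]

/-- The lists in `d` are orbits of `π`, each in the order in which `π` runs through it. -/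
def AreOrbits (π : Perm ℕ) (d : List (List ℕ)) : Prop :=
  ∀ c ∈ d, c ≠ [] ∧ ∀ x ∈ c, π x = c.formPerm x

/-- `d` is a decomposition of the permutation `π` of `{1, …, n}` into disjoint cycles, including the
cycles of length `1`. -/
structure IsDecomp (n : ℕ) (π : Perm ℕ) (d : List (List ℕ)) : Prop where
  nodup : d.flatten.Nodup
  mem : ∀ x, x ∈ d.flatten ↔ 1 ≤ x ∧ x ≤ n
  orbits : AreOrbits π d

theorem perm_range' {n : ℕ} {l : List ℕ} (hl : l.Nodup) (hm : ∀ x, x ∈ l ↔ 1 ≤ x ∧ x ≤ n) :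
    l.Perm (List.range' 1 n) := by
  rw [List.perm_ext_iff_of_nodup hl List.nodup_range']
  intro x
  rw [hm, List.mem_range'_1]
  omega

theorem AreOrbits.apply_mem {π : Perm ℕ} {d : List (List ℕ)} (hd : AreOrbits π d) {c : List ℕ}
    (hc : c ∈ d) {x : ℕ} : π x ∈ c ↔ x ∈ c := by
  constructor
  · intro h
    have h' : c.formPerm⁻¹ (π x) ∈ c := by
      by_contra hn
      have := List.formPerm_apply_of_notMem hn
      rw [Perm.inv_def, Equiv.apply_symm_apply] at this
      rw [Perm.inv_def, ← this] at hn
      exact hn h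
    have := (hd c hc).2 _ h'
    rw [Perm.inv_def, Equiv.apply_symm_apply] at this
    rwa [Perm.inv_def, π.injective this] at h'
  · intro h
    rw [(hd c hc).2 x h]
    exact List.formPerm_apply_mem_of_mem h

theorem AreOrbits.cyclesProd_apply {π : Perm ℕ} {d : List (List ℕ)} (hd : AreOrbits π d)
    (hnd : d.flatten.Nodup) :
    (∀ x ∈ d.flatten, cyclesProd d x = π x) ∧ ∀ x ∉ d.flatten, cyclesProd d x = x := by
  induction d with
  | nil => simp
  | cons c d ih =>
    have hd' : AreOrbits π d := fun c' hc' => hd c' (List.mem_cons_of_mem _ hc')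
    rw [List.flatten_cons, List.nodup_append'] at hnd
    obtain ⟨h₁, h₂⟩ := ih hd' hnd.2.1
    have hc := hd c List.mem_cons_self
    simp only [List.flatten_cons, List.mem_append, cyclesProd_cons, Perm.mul_apply]
    constructor
    · rintro x (hx | hx)
      · rw [h₂ x (fun h => hnd.2.2 hx h), hc.2 x hx]
      · rw [h₁ x hx]
        refine List.formPerm_apply_of_notMem fun h => ?_
        exact hnd.2.2 ((hd.apply_mem List.mem_cons_self).1 h) hx
    · intro x hx
      rw [h₂ x (fun h => hx (Or.inr h))]
      exact List.formPerm_apply_of_notMem fun h => hx (Or.inl h)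

namespace IsDecomp

variable {n : ℕ} {π : Perm ℕ} {d : List (List ℕ)}

theorem length_flatten (h : IsDecomp n π d) : d.flatten.length = n := by
  simpa using (perm_range' h.nodup h.mem).length_eq

theorem cyclesProd_eq (h : IsDecomp n π d) (hπ : π ∈ permsUpTo n) : cyclesProd d = π := by
  obtain ⟨h₁, h₂⟩ := h.orbits.cyclesProd_apply h.nodup
  ext x
  by_cases hx : x ∈ d.flatten
  · exact h₁ x hx
  · rw [h₂ x hx, hπ x (fun h' => hx ((h.mem x).2 h'))]

theorem areCycles (h : IsDecomp n π d) : AreCycles n d := fun c hc =>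
  ⟨(h.orbits c hc).1, (List.nodup_flatten.1 h.nodup).1 c hc, fun x hx =>
    (h.mem x).1 (List.mem_flatten.2 ⟨c, hc, hx⟩)⟩

theorem reverse (h : IsDecomp n π d) : IsDecomp n π d.reverse := by
  have hp : d.reverse.flatten.Perm d.flatten := (List.reverse_perm d).flatten
  exact ⟨hp.nodup_iff.2 h.nodup, fun x => hp.mem_iff.trans (h.mem x),
    fun c hc => h.orbits c (List.mem_reverse.1 hc)⟩

/-- The decomposition of an `n`-cycle has a single member, which represents that cycle. -/
theorem eq_singleton {e : List ℕ} (h : IsDecomp n e.formPerm d) (hn : 1 ≤ n) (he : e.Nodup)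
    (hm : ∀ x, x ∈ e ↔ 1 ≤ x ∧ x ≤ n) :
    ∃ c, d = [c] ∧ c.formPerm = e.formPerm ∧ c.Nodup ∧ ∀ x, x ∈ c ↔ 1 ≤ x ∧ x ≤ n := by
  obtain _ | ⟨c, d⟩ := d
  · have := (h.mem 1).2 ⟨le_rfl, hn⟩
    simp at this
  have hnd := h.nodup
  rw [List.flatten_cons, List.nodup_append'] at hnd
  have hc : ∀ x, x ∈ c ↔ 1 ≤ x ∧ x ≤ n := by
    intro x
    refine ⟨fun hx => (h.mem x).1 (by simp [hx]), fun hx => ?_⟩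
    -- A set that the cycle `e` maps to itself contains all points of `e` or none.
    obtain ⟨y, l, hy⟩ := List.exists_cons_of_ne_nil (h.orbits c List.mem_cons_self).1
    have hyc : y ∈ c := hy ▸ List.mem_cons_self
    obtain ⟨i, hi, hie⟩ := List.getElem_of_mem ((hm y).2 ((h.mem y).1 (by simp [hyc])))
    obtain ⟨j, hj, rfl⟩ := List.getElem_of_mem ((hm x).2 hx)
    have hpow : ∀ k, (e.formPerm ^ k) y ∈ c := by
      intro k
      induction k with
      | zero => simpa
      | succ k ih =>
        rw [pow_succ', Perm.mul_apply]
        exact (h.orbits.apply_mem List.mem_cons_self).2 ih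
    have h' := hpow (e.length - i + j)
    rw [← hie, List.formPerm_pow_apply_getElem _ he] at h'
    have : (i + (e.length - i + j)) % e.length = j := by
      rw [show i + (e.length - i + j) = j + e.length by omega, Nat.add_mod_right,
        Nat.mod_eq_of_lt hj]
    simpa only [this] using h'
  have hd : d = [] := by
    by_contra hne
    obtain ⟨c', d', rfl⟩ := List.exists_cons_of_ne_nil hne
    obtain ⟨y, l, rfl⟩ := List.exists_cons_of_ne_nil (h.orbits c' (by simp)).1
    have : 1 ≤ y ∧ y ≤ n := (h.mem y).1 (by simp)
    exact hnd.2.2 ((hc y).2 this) (by simp)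
  subst hd
  have := h.cyclesProd_eq (formPerm_mem_permsUpTo fun x hx => (hm x).1 hx)
  exact ⟨c, rfl, by simpa using this, hnd.1, hc⟩

end IsDecomp

/-! ### Tracing the cycles of a permutation -/

/-- The array that marks the points of the list `S`. -/
def marks (n : ℕ) (S : List ℕ) : List ℕ := table n fun x => if x ∈ S then 1 else 0

theorem marks_set (n : ℕ) (S : List ℕ) {x : ℕ} (hx : 1 ≤ x) :
    (marks n S).set (x - 1) 1 = marks n (S ++ [x]) := by
  rw [marks, marks, table_set _ _ hx]
  refine table_congr fun y _ => ?_
  by_cases h : y = x <;> simp [h]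

theorem replicate_eq_marks (n : ℕ) : List.replicate n 0 = marks n [] := by
  simp [marks, table]

theorem marks_getD {n : ℕ} (S : List ℕ) {x : ℕ} (hx : 1 ≤ x ∧ x ≤ n) :
    (marks n S).getD (x - 1) 0 = if x ∈ S then 1 else 0 := table_getD _ hx

/-- The state of the search for the cycles of `π`: `d` holds complete orbits, and `c` a part of one
more orbit, from `start` to `last`. -/
structure Tracing (n : ℕ) (π : Perm ℕ) (d : List (List ℕ)) (c : List ℕ) (start last : ℕ) :
    Prop where
  nodup : (d.flatten ++ c).Nodup
  range : ∀ x ∈ d.flatten ++ c, 1 ≤ x ∧ x ≤ n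
  orbits : AreOrbits π d
  current : ∃ m, c = orbitList π start (m + 1) ∧ last = (π ^ m) start

namespace Tracing

variable {n : ℕ} {π : Perm ℕ} {d : List (List ℕ)} {c : List ℕ} {start last : ℕ}

theorem init {x : ℕ} (hx : 1 ≤ x ∧ x ≤ n) : Tracing n π [] [x] x x :=
  ⟨by simp, by simpa using hx, by simp [AreOrbits], 0, by simp [orbitList], by simp⟩

theorem last_mem (h : Tracing n π d c start last) : last ∈ c := by
  obtain ⟨m, rfl, rfl⟩ := h.current
  simp [orbitList_succ]

theorem last_range (h : Tracing n π d c start last) : 1 ≤ last ∧ last ≤ n :=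
  h.range _ (List.mem_append_right _ h.last_mem)

/-- When the orbit returns to its first point, it is complete. -/
theorem orbits_append (h : Tracing n π d c start last) (hl : π last = start) :
    AreOrbits π (d ++ [c]) := by
  intro c' hc'
  rcases List.mem_append.1 hc' with hc' | hc'
  · exact h.orbits c' hc'
  · obtain rfl := List.mem_singleton.1 hc'
    obtain ⟨m, rfl, rfl⟩ := h.current
    refine ⟨by simp [orbitList_succ], fun x hx => ?_⟩
    refine apply_eq_formPerm_orbitList (List.nodup_append'.1 h.nodup).2.1 ?_ hx
    rw [pow_succ', Perm.mul_apply, hl]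

theorem isDecomp (h : Tracing n π d c start last) (hl : π last = start)
    (hall : ∀ x, 1 ≤ x ∧ x ≤ n → x ∈ d.flatten ++ c) : IsDecomp n π (d ++ [c]) := by
  have hf : (d ++ [c]).flatten = d.flatten ++ c := by simp
  exact ⟨by rw [hf]; exact h.nodup, fun x => by rw [hf]; exact ⟨h.range x, hall x⟩,
    h.orbits_append hl⟩

theorem restart (h : Tracing n π d c start last) (hl : π last = start) {x : ℕ}
    (hx : 1 ≤ x ∧ x ≤ n) (hx' : x ∉ d.flatten ++ c) : Tracing n π (d ++ [c]) [x] x x := by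
  have hf : (d ++ [c]).flatten = d.flatten ++ c := by simp
  refine ⟨?_, ?_, h.orbits_append hl, 0, by simp [orbitList], by simp⟩
  · rw [hf, List.nodup_append']
    exact ⟨h.nodup, by simp, by simpa using hx'⟩
  · intro y hy
    rw [hf, List.mem_append, List.mem_singleton] at hy
    rcases hy with hy | rfl
    · exact h.range y hy
    · exact hx

/-- The next point of an incomplete orbit has not been visited before. -/
theorem apply_notMem (h : Tracing n π d c start last) (hl : π last ≠ start) :
    π last ∉ d.flatten ++ c := by
  intro hmem
  have hnd := List.nodup_append'.1 h.nodup
  rcases List.mem_append.1 hmem with hmem | hmem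
  · obtain ⟨c', hc', hmem⟩ := List.mem_flatten.1 hmem
    have := (h.orbits.apply_mem hc').1 hmem
    exact hnd.2.2 (List.mem_flatten.2 ⟨c', hc', this⟩) h.last_mem
  · obtain ⟨m, rfl, rfl⟩ := h.current
    obtain ⟨j, hj, hj'⟩ := mem_orbitList.1 hmem
    obtain _ | j := j
    · exact hl (by simpa using hj'.symm)
    · rw [pow_succ', Perm.mul_apply] at hj'
      have h₁ := π.injective hj'
      have := hnd.2.1.getElem_inj_iff (i := j) (j := m) (hi := by simp; omega) (hj := by simp)
      simp only [getElem_orbitList] at this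
      have := this.1 h₁
      omega

theorem extend (h : Tracing n π d c start last) (hπ : π ∈ permsUpTo n) (hl : π last ≠ start) :
    Tracing n π d (c ++ [π last]) start (π last) := by
  have hnew := h.apply_notMem hl
  refine ⟨?_, ?_, h.orbits, ?_⟩
  · rw [← List.append_assoc, List.nodup_append']
    exact ⟨h.nodup, by simp, by simpa using hnew⟩
  · intro y hy
    rw [← List.append_assoc, List.mem_append, List.mem_singleton] at hy
    rcases hy with hy | rfl
    · exact h.range y hy
    · exact apply_mem_range hπ h.last_range
  · obtain ⟨m, rfl, rfl⟩ := h.current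
    refine ⟨m + 1, ?_, ?_⟩
    · rw [orbitList_succ _ _ (m + 1), pow_succ', Perm.mul_apply]
    · rw [pow_succ', Perm.mul_apply]

end Tracing

/-! ### Subalgorithm B -/

theorem computes_firstUnused (l : List ℕ) (j : ℕ) :
    ∃ r, Computes (firstUnused l j) r (2 * l.length + 1) ∧
      ((r = 0 ∧ ∀ i < l.length, l.getD i 0 ≠ 0) ∨ ∃ i < l.length, r = j + i ∧ l.getD i 0 = 0) := by
  induction l generalizing j with
  | nil => exact ⟨0, .op _, by simp⟩
  | cons u l ih =>
    rcases eq_or_ne u 0 with rfl | hu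
    · refine ⟨j, ?_, Or.inr ⟨0, by simp⟩⟩
      refine .mono (Computes.tick_bind (Computes.test_true (by simp) (.op _))) ?_
      simp only [List.length_cons]
      omega
    · obtain ⟨r, hr, h⟩ := ih (j + 1)
      refine ⟨r, ?_, ?_⟩
      · refine .mono (Computes.tick_bind (Computes.test_false (by simpa using hu) hr)) ?_
        simp only [List.length_cons]
        omega
      · rcases h with ⟨h₁, h₂⟩ | ⟨i, hi, hr', hi'⟩
        · refine Or.inl ⟨h₁, ?_⟩
          rintro (_ | i) hi
          · simpa using hu
          · simpa using h₂ i (by simpa using hi)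
        · exact Or.inr ⟨i + 1, by simpa using hi, by omega, by simpa using hi'⟩

theorem computes_firstUnused_marks (n : ℕ) (S : List ℕ) :
    ∃ r, Computes (firstUnused (marks n S) 1) r (2 * n + 1) ∧
      ((r = 0 ∧ ∀ x, 1 ≤ x ∧ x ≤ n → x ∈ S) ∨ ((1 ≤ r ∧ r ≤ n) ∧ r ∉ S)) := by
  obtain ⟨r, hr, h⟩ := computes_firstUnused (marks n S) 1
  have hlen : (marks n S).length = n := length_table _ _
  rw [hlen] at hr h
  refine ⟨r, hr, ?_⟩
  rcases h with ⟨h₁, h₂⟩ | ⟨i, hi, rfl, hi'⟩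
  · refine Or.inl ⟨h₁, fun x hx => ?_⟩
    have := h₂ (x - 1) (by omega)
    rw [marks_getD S hx] at this
    by_contra hxS
    simp [hxS] at this
  · refine Or.inr ⟨by omega, fun hS => ?_⟩
    have := marks_getD S (n := n) (x := 1 + i) (by omega)
    rw [if_pos hS, Nat.add_sub_cancel_left, hi'] at this
    omega

theorem computes_subBLoop {n : ℕ} {π : Perm ℕ} (hπ : π ∈ permsUpTo n) (u : ℕ)
    {d : List (List ℕ)} {c : List ℕ} {start col : ℕ} (h : Tracing n π d c start col)
    (hu : (d.flatten ++ c).length + u = n) :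
    ∃ d', Computes (subBLoop (table n π) (marks n (d.flatten ++ c)) d c start col) d'
      ((u + 1) * (2 * n + 10)) ∧ IsDecomp n π d' := by
  induction u generalizing d c start col with
  | zero =>
    have hall : ∀ x, 1 ≤ x ∧ x ≤ n → x ∈ d.flatten ++ c := by
      have := (List.subperm_of_subset h.nodup (l₂ := List.range' 1 n) fun x hx => by
        have := h.range x hx
        rw [List.mem_range'_1]
        omega).perm_of_length_le (by simp at hu ⊢; omega)
      intro x hx
      rw [this.mem_iff, List.mem_range'_1]
      omega
    have hl : π col = start := by
      by_contra hl
      exact h.apply_notMem hl (hall _ (apply_mem_range hπ h.last_range))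
    obtain ⟨r, hr, h'⟩ := computes_firstUnused_marks n (d.flatten ++ c)
    obtain ⟨rfl, -⟩ : r = 0 ∧ True := by
      rcases h' with h' | h'
      · exact ⟨h'.1, trivial⟩
      · exact absurd (hall r h'.1) h'.2
    refine ⟨d ++ [c], ?_, h.isDecomp hl hall⟩
    rw [subBLoop]
    refine .mono (Computes.op_bind (Computes.test_true ?_ (Computes.op_bind
      (hr.bind (Computes.test_true (by simp) (.op _)))))) ?_
    · rw [table_getD _ h.last_range]
      simpa using hl
    · omega
  | succ u ih =>
    have hget := table_getD π h.last_range
    rw [subBLoop]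
    by_cases hl : π col = start
    · obtain ⟨r, hr, h'⟩ := computes_firstUnused_marks n (d.flatten ++ c)
      rcases h' with ⟨rfl, hall⟩ | ⟨hrn, hrS⟩
      · refine ⟨d ++ [c], ?_, h.isDecomp hl hall⟩
        refine .mono (Computes.op_bind (Computes.test_true (by rw [hget]; simpa using hl)
          (Computes.op_bind (hr.bind (Computes.test_true (by simp) (.op _)))))) ?_
        rw [add_mul]
        omega
      · have hnext := h.restart hl hrn hrS
        obtain ⟨d', hd', hdec⟩ := ih hnext (by simp at hu ⊢; omega)
        refine ⟨d', ?_, hdec⟩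
        rw [List.flatten_concat, ← marks_set _ _ hrn.1] at hd'
        refine .mono (Computes.op_bind (Computes.test_true (by rw [hget]; simpa using hl)
          (Computes.op_bind (hr.bind (Computes.test_false (by simp; omega)
          (Computes.op_bind (Computes.op_bind (Computes.op_bind
            (Computes.tick_bind hd'))))))))) ?_
        simp only [add_mul]
        omega
    · have hnext := h.extend hπ hl
      obtain ⟨d', hd', hdec⟩ := ih hnext (by simp at hu ⊢; omega)
      refine ⟨d', ?_, hdec⟩
      rw [← List.append_assoc, ← marks_set _ _ hnext.last_range.1, ← hget] at hd'
      refine .mono (Computes.op_bind (Computes.test_false (by rw [hget]; simpa using hl)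
        (Computes.op_bind (Computes.op_bind (Computes.op_bind (Computes.tick_bind hd')))))) ?_
      simp only [add_mul]
      omega

theorem computes_subB {n : ℕ} (hn : 1 ≤ n) {π : Perm ℕ} (hπ : π ∈ permsUpTo n) :
    ∃ d, Computes (subB n (table n π)) d (n * (2 * n + 10) + 2 * n + 7) ∧ IsDecomp n π d := by
  obtain ⟨m, rfl⟩ := Nat.exists_eq_add_of_le' hn
  obtain ⟨d, hd, hdec⟩ := computes_subBLoop hπ m
    (Tracing.init (n := m + 1) (π := π) (x := 1) (by omega)) (by simp; omega)
  refine ⟨d, ?_, hdec⟩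
  rw [List.flatten_nil, ← marks_set _ _ le_rfl, ← replicate_eq_marks] at hd
  refine .mono (Computes.tick_bind ((computes_zeros _).bind (Computes.op_bind (Computes.op_bind
    (Computes.op_bind (Computes.op_bind (Computes.op_bind hd))))))) ?_
  omega

/-! ### Subalgorithm D -/

theorem computes_firstUnusedIn (used l : List ℕ) (i : ℕ) :
    ∃ k a, Computes (firstUnusedIn used l i) (k, a) (2 * l.length + 1) ∧
      ((a = 0 ∧ ∀ x ∈ l, used.getD (x - 1) 0 ≠ 0) ∨
        ∃ j < l.length, k = i + j ∧ l.getD j 0 = a ∧ used.getD (a - 1) 0 = 0) := by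
  induction l generalizing i with
  | nil => exact ⟨i, 0, .op _, by simp⟩
  | cons b l ih =>
    by_cases hb : used.getD (b - 1) 0 = 0
    · refine ⟨i, b, ?_, Or.inr ⟨0, by simp, rfl, by simp, hb⟩⟩
      refine .mono (Computes.tick_bind (Computes.test_true (by simpa using hb) (.op _))) ?_
      simp only [List.length_cons]
      omega
    · obtain ⟨k, a, hr, h⟩ := ih (i + 1)
      refine ⟨k, a, ?_, ?_⟩
      · refine .mono (Computes.tick_bind (Computes.test_false (by simpa using hb) hr)) ?_
        simp only [List.length_cons]
        omega
      · rcases h with ⟨h₁, h₂⟩ | ⟨j, hj, hk, hj', ha⟩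
        · refine Or.inl ⟨h₁, fun x hx => ?_⟩
          rcases List.mem_cons.1 hx with rfl | hx
          · exact hb
          · exact h₂ x hx
        · exact Or.inr ⟨j + 1, by simpa using hj, by omega, by simpa using hj', ha⟩

theorem computes_firstUnusedIn_marks {n : ℕ} (S : List ℕ) {l : List ℕ} (hl : l.Nodup)
    (hm : ∀ x, x ∈ l ↔ 1 ≤ x ∧ x ≤ n) :
    ∃ k a, Computes (firstUnusedIn (marks n S) l 0) (k, a) (2 * n + 1) ∧
      ((a = 0 ∧ ∀ x, 1 ≤ x ∧ x ≤ n → x ∈ S) ∨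
        ((1 ≤ a ∧ a ≤ n) ∧ a ∉ S ∧ k < n ∧ l.getD k 0 = a)) := by
  obtain ⟨k, a, hr, h⟩ := computes_firstUnusedIn (marks n S) l 0
  have hlen : l.length = n := by simpa using (perm_range' hl hm).length_eq
  rw [hlen] at hr h
  refine ⟨k, a, hr, ?_⟩
  rcases h with ⟨h₁, h₂⟩ | ⟨j, hj, hk, hja, ha⟩
  · refine Or.inl ⟨h₁, fun x hx => ?_⟩
    have := h₂ x ((hm x).2 hx)
    rw [marks_getD S hx] at this
    by_contra hxS
    simp [hxS] at this
  · have han : 1 ≤ a ∧ a ≤ n := by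
      rw [← hm, ← hja, List.getD_eq_getElem _ _ (by omega)]
      exact List.getElem_mem _
    refine Or.inr ⟨han, fun hS => ?_, by omega, by rw [hk, Nat.zero_add]; exact hja⟩
    rw [marks_getD S han, if_pos hS] at ha
    omega

theorem computes_subDLoop {n : ℕ} {π : Perm ℕ} (hπ : π ∈ permsUpTo n) {e : List ℕ}
    (he : e.Nodup) (hm : ∀ x, x ∈ e ↔ 1 ≤ x ∧ x ≤ n) (u : ℕ)
    {d : List (List ℕ)} {c : List ℕ} {start last i : ℕ} (h : Tracing n π d c start last)
    (hi : i < n) (hil : e.getD i 0 = last) (hu : (d.flatten ++ c).length + u = n) :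
    ∃ d', Computes (subDLoop e (e.map π) (marks n (d.flatten ++ c)) d c start i) d'
      ((u + 1) * (3 * n + 10)) ∧ IsDecomp n π d' := by
  have hlen : e.length = n := by simpa using (perm_range' he hm).length_eq
  induction u generalizing d c start last i with
  | zero =>
    have hget : (e.map π).getD i 0 = π last := by
      rw [← hil, List.getD_eq_getElem _ _ (by simpa [hlen]),
        List.getD_eq_getElem _ _ (by simpa [hlen]), List.getElem_map]
    have hall : ∀ x, 1 ≤ x ∧ x ≤ n → x ∈ d.flatten ++ c := by
      have := (List.subperm_of_subset h.nodup (l₂ := List.range' 1 n) fun x hx => by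
        have := h.range x hx
        rw [List.mem_range'_1]
        omega).perm_of_length_le (by simp at hu ⊢; omega)
      intro x hx
      rw [this.mem_iff, List.mem_range'_1]
      omega
    have hl : π last = start := by
      by_contra hl
      exact h.apply_notMem hl (hall _ (apply_mem_range hπ h.last_range))
    obtain ⟨k, a, hr, h'⟩ := computes_firstUnusedIn_marks (d.flatten ++ c) he hm
    obtain ⟨rfl, -⟩ : a = 0 ∧ True := by
      rcases h' with h' | h'
      · exact ⟨h'.1, trivial⟩
      · exact absurd (hall a h'.1) h'.2.1
    refine ⟨d ++ [c], ?_, h.isDecomp hl hall⟩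
    rw [subDLoop]
    refine .mono (Computes.op_bind (Computes.test_true (by rw [hget]; simpa using hl)
      (Computes.op_bind (hr.bind (Computes.test_true (by simp) (.op _)))))) ?_
    omega
  | succ u ih =>
    have hget : (e.map π).getD i 0 = π last := by
      rw [← hil, List.getD_eq_getElem _ _ (by simpa [hlen]),
        List.getD_eq_getElem _ _ (by simpa [hlen]), List.getElem_map]
    rw [subDLoop]
    by_cases hl : π last = start
    · obtain ⟨k, a, hr, h'⟩ := computes_firstUnusedIn_marks (d.flatten ++ c) he hm
      rcases h' with ⟨rfl, hall⟩ | ⟨han, haS, hk, hka⟩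
      · refine ⟨d ++ [c], ?_, h.isDecomp hl hall⟩
        refine .mono (Computes.op_bind (Computes.test_true (by rw [hget]; simpa using hl)
          (Computes.op_bind (hr.bind (Computes.test_true (by simp) (.op _)))))) ?_
        rw [add_mul]
        omega
      · obtain ⟨d', hd', hdec⟩ := ih (h.restart hl han haS) hk hka (by simp at hu ⊢; omega)
        refine ⟨d', ?_, hdec⟩
        rw [List.flatten_concat, ← marks_set _ _ han.1] at hd'
        refine .mono (Computes.op_bind (Computes.test_true (by rw [hget]; simpa using hl)
          (Computes.op_bind (hr.bind (Computes.test_false (by simp; omega)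
          (Computes.op_bind (Computes.op_bind (Computes.tick_bind hd')))))))) ?_
        simp only [add_mul]
        omega
    · have hnext := h.extend hπ hl
      have hmem : π last ∈ e := (hm _).2 hnext.last_range
      have hidx : e.idxOf (π last) < n := hlen ▸ List.idxOf_lt_length_of_mem hmem
      obtain ⟨d', hd', hdec⟩ := ih hnext hidx
        (by rw [List.getD_eq_getElem _ _ (by omega), List.getElem_idxOf])
        (by simp at hu ⊢; omega)
      refine ⟨d', ?_, hdec⟩
      rw [← List.append_assoc, ← marks_set _ _ hnext.last_range.1, ← hget] at hd'
      refine .mono (Computes.op_bind (Computes.test_false (by rw [hget]; simpa using hl)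
        (Computes.op_bind (Computes.op_bind ((computes_find _ _).bind
          (Computes.tick_bind hd')))))) ?_
      simp only [add_mul, hlen]
      omega

theorem computes_subD {n : ℕ} (hn : 1 ≤ n) {π : Perm ℕ} (hπ : π ∈ permsUpTo n) {e : List ℕ}
    (he : e.Nodup) (hm : ∀ x, x ∈ e ↔ 1 ≤ x ∧ x ≤ n) :
    ∃ d, Computes (subD n e (e.map π)) d (n * (3 * n + 10) + 2 * n + 7) ∧ IsDecomp n π d := by
  have hlen : e.length = n := by simpa using (perm_range' he hm).length_eq
  obtain ⟨m, rfl⟩ := Nat.exists_eq_add_of_le' hn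
  have hs : 1 ≤ e.getD 0 0 ∧ e.getD 0 0 ≤ m + 1 := by
    rw [← hm, List.getD_eq_getElem _ _ (by omega)]
    exact List.getElem_mem _
  obtain ⟨d, hd, hdec⟩ := computes_subDLoop hπ he hm m (Tracing.init (π := π) hs) hn rfl
    (by simp; omega)
  refine ⟨d, ?_, hdec⟩
  rw [List.flatten_nil, ← marks_set _ _ hs.1, ← replicate_eq_marks] at hd
  refine .mono (Computes.tick_bind ((computes_zeros _).bind (Computes.op_bind (Computes.op_bind
    (Computes.op_bind (Computes.op_bind (Computes.op_bind hd))))))) ?_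
  omega

/-- A bijection between the entries of two lists without repetitions extends to a permutation that
fixes all points outside the two lists. -/
theorem exists_perm_map {l₁ l₂ : List ℕ} (h₁ : l₁.Nodup) (h₂ : l₂.Nodup)
    (hl : l₁.length = l₂.length) :
    ∃ σ : Perm ℕ, l₁.map σ = l₂ ∧ ∀ x, x ∉ l₁ → x ∉ l₂ → σ x = x := by
  induction l₁ generalizing l₂ with
  | nil => exact ⟨1, by simpa using hl.symm, by simp⟩
  | cons a l₁ ih =>
    obtain _ | ⟨b, l₂⟩ := l₂
    · simp at hl
    rw [List.nodup_cons] at h₁ h₂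
    obtain ⟨σ, hσ, hfix⟩ := ih h₁.2 h₂.2 (by simpa using hl)
    refine ⟨swap (σ a) b * σ, ?_, fun x hx₁ hx₂ => ?_⟩
    · rw [List.map_cons, Perm.mul_apply, Equiv.swap_apply_left, ← hσ]
      congr 1
      refine List.map_congr_left fun x hx => ?_
      rw [Perm.mul_apply]
      refine Equiv.swap_apply_of_ne_of_ne (fun h => ?_) (fun h => h₂.1 ?_)
      · exact h₁.1 (σ.injective h ▸ hx)
      · rw [← hσ, ← h]
        exact List.mem_map_of_mem hx
    · simp only [List.mem_cons, not_or] at hx₁ hx₂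
      have hx := hfix x hx₁.2 hx₂.2
      rw [Perm.mul_apply, hx]
      refine Equiv.swap_apply_of_ne_of_ne (fun h => ?_) hx₂.1
      exact hx₁.1 (σ.injective (hx.trans h))

/-! ### Products of two cycles -/

theorem formPerm_append_cons (l₁ : List ℕ) (a : ℕ) (l₂ : List ℕ) :
    (l₁ ++ a :: l₂).formPerm = (l₁ ++ [a]).formPerm * (a :: l₂).formPerm := by
  induction l₁ with
  | nil => simp
  | cons x l₁ ih =>
    cases l₁ with
    | nil => simp
    | cons y l₁ =>
      simp only [List.cons_append, List.formPerm_cons_cons] at ih ⊢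
      rw [ih, mul_assoc]

theorem disjoint_formPerm {p q : List ℕ} (h : p.Disjoint q) :
    Perm.Disjoint p.formPerm q.formPerm := by
  intro x
  by_cases hx : x ∈ p
  · exact Or.inr (List.formPerm_apply_of_notMem fun hx' => h hx hx')
  · exact Or.inl (List.formPerm_apply_of_notMem hx)

theorem formPerm_cons_append_cons {u v : ℕ} {p q : List ℕ} (h : (u :: p ++ v :: q).Nodup) :
    swap u v * (u :: p).formPerm * (v :: q).formPerm = (u :: p ++ v :: q).formPerm := by
  have hr : ((u :: p) ++ [v]).formPerm = (v :: u :: p).formPerm := by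
    refine List.formPerm_eq_of_isRotated ?_ List.isRotated_append
    refine h.sublist ?_
    exact List.Sublist.append_left (by simp) _
  rw [formPerm_append_cons, hr, List.formPerm_cons_cons, Equiv.swap_comm]

theorem exists_isRotated_cons {u : ℕ} {e : List ℕ} (h : u ∈ e) : ∃ p, e ~r (u :: p) := by
  obtain ⟨s, t, rfl⟩ := List.append_of_mem h
  exact ⟨t ++ s, List.isRotated_append⟩

/-- A transposition joins two disjoint cycles to a single one. -/
theorem exists_swap_mul_formPerm {e₁ e₂ : List ℕ} (h : (e₁ ++ e₂).Nodup) {u v : ℕ} (hu : u ∈ e₁)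
    (hv : v ∈ e₂) :
    ∃ e : List ℕ, e.Perm (e₁ ++ e₂) ∧ swap u v * e₁.formPerm * e₂.formPerm = e.formPerm := by
  obtain ⟨p, hp⟩ := exists_isRotated_cons hu
  obtain ⟨q, hq⟩ := exists_isRotated_cons hv
  have hperm := hp.perm.append hq.perm
  rw [List.formPerm_eq_of_isRotated (List.nodup_append'.1 h).1 hp,
    List.formPerm_eq_of_isRotated (List.nodup_append'.1 h).2.1 hq]
  exact ⟨_, hperm.symm, formPerm_cons_append_cons (hperm.nodup_iff.1 h)⟩

theorem exists_formPerm_mul_swap {e₁ e₂ : List ℕ} (h : (e₁ ++ e₂).Nodup) {u v : ℕ} (hu : u ∈ e₁)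
    (hv : v ∈ e₂) :
    ∃ e : List ℕ, e.Perm (e₁ ++ e₂) ∧ e₁.formPerm * e₂.formPerm * swap u v = e.formPerm := by
  obtain ⟨e, he, h'⟩ := exists_swap_mul_formPerm h hu hv
  refine ⟨e.map (swap u v), ?_, ?_⟩
  · -- The transposition exchanges two of the points and thus permutes the entries.
    have hmem : ∀ x, x ∈ e → swap u v x ∈ e := by
      intro x hx
      by_cases h₁ : x = u
      · rw [h₁, Equiv.swap_apply_left]
        exact he.mem_iff.2 (List.mem_append_right _ hv)
      · by_cases h₂ : x = v
        · rw [h₂, Equiv.swap_apply_right]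
          exact he.mem_iff.2 (List.mem_append_left _ hu)
        · rwa [Equiv.swap_apply_of_ne_of_ne h₁ h₂]
    refine List.Perm.trans ?_ he
    have hnd := (he.nodup_iff.2 h).map (Equiv.injective (swap u v))
    refine (List.subperm_of_subset hnd ?_).perm_of_length_le (by simp)
    intro x hx
    obtain ⟨y, hy, rfl⟩ := List.mem_map.1 hx
    exact hmem y hy
  · -- This product is conjugate under the transposition to the one with the transposition in front.
    rw [formPerm_map, ← h', Equiv.swap_inv]
    simp only [← mul_assoc, Equiv.swap_mul_self, one_mul]

/-- The place that follows the place `j` in a cycle of length `m`. -/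
def nextPlace (m j : ℕ) : ℕ := if j + 1 = m then 0 else j + 1

theorem formPerm_apply_getD {l : List ℕ} (h : l.Nodup) {j : ℕ} (hj : j < l.length) :
    l.formPerm (l.getD j 0) = l.getD (nextPlace l.length j) 0 := by
  have hlt : nextPlace l.length j < l.length := by unfold nextPlace; split <;> omega
  rw [List.getD_eq_getElem _ _ hj, List.getD_eq_getElem _ _ hlt, List.formPerm_apply_getElem _ h]
  congr 1
  unfold nextPlace
  split
  · next h' => rw [h', Nat.mod_self]
  · rw [Nat.mod_eq_of_lt (by omega)]

theorem exists_getD_of_mem {l : List ℕ} {x : ℕ} (h : x ∈ l) :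
    ∃ j < l.length, l.getD j 0 = x := by
  obtain ⟨j, hj, rfl⟩ := List.getElem_of_mem h
  exact ⟨j, hj, List.getD_eq_getElem _ _ hj⟩

/-- A permutation is determined by moving each entry of two disjoint lists to the next place. -/
theorem eq_formPerm_mul_formPerm {σ : Perm ℕ} {p q : List ℕ} (h : (p ++ q).Nodup)
    (hp : ∀ j < p.length, σ (p.getD j 0) = p.getD (nextPlace p.length j) 0)
    (hq : ∀ j < q.length, σ (q.getD j 0) = q.getD (nextPlace q.length j) 0)
    (hσ : ∀ x ∉ p ++ q, σ x = x) : σ = p.formPerm * q.formPerm := by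
  obtain ⟨hpn, hqn, hd⟩ := List.nodup_append'.1 h
  ext x
  rw [Perm.mul_apply]
  by_cases hxp : x ∈ p
  · rw [List.formPerm_apply_of_notMem (l := q) fun hxq => hd hxp hxq]
    obtain ⟨j, hj, rfl⟩ := exists_getD_of_mem hxp
    rw [hp j hj, formPerm_apply_getD hpn hj]
  · by_cases hxq : x ∈ q
    · rw [List.formPerm_apply_of_notMem (l := p) fun hx =>
        hd hx (List.formPerm_apply_mem_of_mem hxq)]
      obtain ⟨j, hj, rfl⟩ := exists_getD_of_mem hxq
      rw [hq j hj, formPerm_apply_getD hqn hj]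
    · rw [List.formPerm_apply_of_notMem hxq, List.formPerm_apply_of_notMem hxp]
      exact hσ x (by simp [hxp, hxq])

/-- The square of a cycle of even length is the product of two cycles. -/
theorem formPerm_interleaved_mul_self {p q : List ℕ} (h : (p ++ q).Nodup)
    (hl : p.length = q.length) :
    (interleaved p q).formPerm * (interleaved p q).formPerm = p.formPerm * q.formPerm := by
  have hperm := interleaved_perm hl
  have hnd := hperm.nodup_iff.2 h
  have hlen := length_interleaved hl
  refine eq_formPerm_mul_formPerm h (fun j hj => ?_) (fun j hj => ?_) (fun x hx => ?_)
  · rw [Perm.mul_apply, ← interleaved_getD_even hl, formPerm_apply_getD hnd (by omega),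
      formPerm_apply_getD hnd (by unfold nextPlace; split <;> omega), ← interleaved_getD_even hl]
    congr 1
    unfold nextPlace
    grind
  · rw [Perm.mul_apply, ← interleaved_getD_odd hl, formPerm_apply_getD hnd (by omega),
      formPerm_apply_getD hnd (by unfold nextPlace; split <;> omega), ← interleaved_getD_odd hl]
    congr 1
    unfold nextPlace
    grind
  · rw [← hperm.mem_iff] at hx
    rw [Perm.mul_apply, List.formPerm_apply_of_notMem hx, List.formPerm_apply_of_notMem hx]

/-- The sequence `i₁ i_{b+1} ⋯ i_N i₂ ⋯ i_b` from the sequence `i₁ ⋯ i_N`. -/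
def movedBlock (b : ℕ) (i : List ℕ) : List ℕ := i.headD 0 :: (i.drop b ++ (i.take b).tail)

theorem movedBlock_perm {b : ℕ} {i : List ℕ} (hb : 1 ≤ b) (hi : i ≠ []) :
    (movedBlock b i).Perm i := by
  obtain ⟨x, l, rfl⟩ := List.exists_cons_of_ne_nil hi
  obtain ⟨b, rfl⟩ := Nat.exists_eq_add_of_le' hb
  simp only [movedBlock, List.headD_cons, List.drop_succ_cons, List.take_succ_cons, List.tail_cons]
  refine List.Perm.cons _ (List.perm_append_comm.trans ?_)
  rw [List.take_append_drop]

/-- The position of the entry number `k` of a sequence after moving a block. -/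
theorem movedBlock_getD {b : ℕ} {i : List ℕ} (hb : 1 ≤ b) (hbi : b ≤ i.length) {k : ℕ}
    (hk : k < i.length) :
    (movedBlock b i).getD (if k = 0 then 0 else if k < b then k + (i.length - b) else k - b + 1) 0 =
      i.getD k 0 := by
  have hi : i ≠ [] := by
    rintro rfl
    simp at hk
  obtain ⟨x, l, rfl⟩ := List.exists_cons_of_ne_nil hi
  obtain ⟨b, rfl⟩ := Nat.exists_eq_add_of_le' hb
  simp only [List.length_cons] at hbi hk
  simp only [movedBlock, List.headD_cons, List.drop_succ_cons, List.take_succ_cons, List.tail_cons,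
    List.length_cons]
  obtain _ | k := k
  · simp
  · rw [if_neg (by omega)]
    by_cases h : k < b
    · rw [if_pos (by omega),
        show k + 1 + (l.length + 1 - (b + 1)) = (k + (l.length - b)) + 1 by omega]
      simp only [List.getD_cons_succ]
      rw [List.getD_append_right _ _ _ _ (by simp)]
      rw [List.length_drop, Nat.add_sub_cancel, List.getD_eq_getElem?_getD,
        List.getD_eq_getElem?_getD, List.getElem?_take_of_lt h]
    · rw [if_neg (by omega), show k + 1 - (b + 1) + 1 = (k - b) + 1 by omega]
      simp only [List.getD_cons_succ]
      rw [List.getD_append _ _ _ _ (by rw [List.length_drop]; omega), List.getD_eq_getElem?_getD,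
        List.getD_eq_getElem?_getD, List.getElem?_drop, Nat.add_sub_cancel' (by omega)]

/-- The effect of the cycle with a moved block on the original sequence. -/
theorem formPerm_movedBlock_apply_getD {b : ℕ} {i : List ℕ} (hb : 2 ≤ b) (hbi : b < i.length)
    (hi : i.Nodup) {k : ℕ} (hk : k < i.length) :
    (movedBlock b i).formPerm (i.getD k 0) =
      i.getD (if k = 0 then b else if k + 1 = b then 0 else if k + 1 = i.length then 1 else k + 1)
        0 := by
  have hne : i ≠ [] := by
    rintro rfl
    simp at hk
  have hperm := movedBlock_perm (b := b) (by omega) hne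
  have hlen := hperm.length_eq
  have hb' : 1 ≤ b := by omega
  rw [← movedBlock_getD hb' hbi.le hk,
    formPerm_apply_getD (hperm.nodup_iff.2 hi) (by grind), hlen]
  conv_rhs => rw [← movedBlock_getD hb' hbi.le (by grind)]
  congr 1
  unfold nextPlace
  grind

/-- The product of two cycles of different lengths of the same parity is a product of two long
cycles. -/
theorem formPerm_movedBlock_mul {p q : List ℕ} {m : ℕ} (h : (p ++ q).Nodup) (hp : 1 ≤ p.length)
    (hlt : p.length < q.length) (hm : p.length + q.length = 2 * m) :
    (movedBlock (2 * p.length) (interleaved (p ++ q.drop m) (q.take m))).formPerm *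
      (interleaved (p ++ q.drop m) (q.take m)).formPerm = p.formPerm * q.formPerm := by
  have hl : (p ++ q.drop m).length = (q.take m).length := by simp; omega
  have hlen := length_interleaved hl
  have hperm : (interleaved (p ++ q.drop m) (q.take m)).Perm (p ++ q) := by
    refine (interleaved_perm hl).trans ?_
    rw [List.append_assoc]
    refine List.Perm.append_left _ (List.perm_append_comm.trans ?_)
    rw [List.take_append_drop]
  have hnd := hperm.nodup_iff.2 h
  have hev := interleaved_getD_even hl
  have hod := interleaved_getD_odd hl
  have hlen' : (interleaved (p ++ q.drop m) (q.take m)).length = 2 * m := by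
    rw [hperm.length_eq, List.length_append, hm]
  -- The places of the entries of `p` and of `q` in the interleaved sequence.
  have hpp : ∀ j < p.length, p.getD j 0 =
      (interleaved (p ++ q.drop m) (q.take m)).getD (2 * j) 0 := fun j hj => by
    rw [hev, List.getD_append _ _ _ _ hj]
  have hq₁ : ∀ j < m, q.getD j 0 =
      (interleaved (p ++ q.drop m) (q.take m)).getD (2 * j + 1) 0 := fun j hj => by
    rw [hod, List.getD_eq_getElem?_getD, List.getD_eq_getElem?_getD, List.getElem?_take_of_lt hj]
  have hq₂ : ∀ j, m ≤ j → q.getD j 0 =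
      (interleaved (p ++ q.drop m) (q.take m)).getD (2 * (p.length + (j - m))) 0 := fun j hj => by
    rw [hev, List.getD_append_right _ _ _ _ (by omega), List.getD_eq_getElem?_getD,
      List.getD_eq_getElem?_getD, List.getElem?_drop]
    congr 2
    omega
  generalize interleaved (p ++ q.drop m) (q.take m) = i at *
  have hne : i ≠ [] := by
    rintro rfl
    simp at hlen'
    omega
  have hblock := fun k hk => formPerm_movedBlock_apply_getD (b := 2 * p.length) (i := i) (k := k)
    (by omega) (by omega) hnd hk
  rw [hlen'] at hblock
  have hb₀ : (movedBlock (2 * p.length) i).formPerm (i.getD 0 0) = i.getD (2 * p.length) 0 := by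
    rw [hblock 0 (by omega), if_pos rfl]
  have hb₁ : ∀ k, k + 1 = 2 * p.length →
      (movedBlock (2 * p.length) i).formPerm (i.getD k 0) = i.getD 0 0 := fun k hk => by
    rw [hblock k (by omega), if_neg (by omega), if_pos hk]
  have hb₂ : ∀ k, k + 1 = 2 * m →
      (movedBlock (2 * p.length) i).formPerm (i.getD k 0) = i.getD 1 0 := fun k hk => by
    rw [hblock k (by omega), if_neg (by omega), if_neg (by omega), if_pos hk]
  have hb₃ : ∀ k, 0 < k → k + 1 ≠ 2 * p.length → k + 1 < 2 * m →
      (movedBlock (2 * p.length) i).formPerm (i.getD k 0) = i.getD (k + 1) 0 :=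
    fun k h₀ h₁ h₂ => by
      rw [hblock k (by omega), if_neg (by omega), if_neg h₁, if_neg (by omega)]
  have hs₁ : ∀ k, k + 1 < 2 * m → i.formPerm (i.getD k 0) = i.getD (k + 1) 0 := fun k hk => by
    rw [formPerm_apply_getD hnd (by omega), nextPlace, if_neg (by omega)]
  have hs₂ : ∀ k, k + 1 = 2 * m → i.formPerm (i.getD k 0) = i.getD 0 0 := fun k hk => by
    rw [formPerm_apply_getD hnd (by omega), nextPlace, if_pos (by omega)]
  refine eq_formPerm_mul_formPerm h (fun j hj => ?_) (fun j hj => ?_) (fun x hx => ?_)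
  · rw [Perm.mul_apply, hpp j hj, hs₁ _ (by omega)]
    by_cases hjp : j + 1 = p.length
    · rw [hb₁ _ (by omega), nextPlace, if_pos hjp, hpp 0 (by omega), mul_zero]
    · rw [hb₃ _ (by omega) (by omega) (by omega), nextPlace, if_neg hjp, hpp _ (by omega)]
      rfl
  · rw [Perm.mul_apply]
    rcases Nat.lt_or_ge j m with hjm | hjm
    · rw [hq₁ j hjm, nextPlace, if_neg (by omega)]
      by_cases hjm' : j + 1 = m
      · rw [hs₂ _ (by omega), hb₀, hq₂ _ hjm'.ge, hjm', Nat.sub_self, add_zero]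
      · rw [hs₁ _ (by omega), hb₃ _ (by omega) (by omega) (by omega), hq₁ _ (by omega)]
        rfl
    · rw [hq₂ j hjm, hs₁ _ (by omega), nextPlace]
      by_cases hjq : j + 1 = q.length
      · rw [hb₂ _ (by omega), if_pos hjq, hq₁ 0 (by omega)]
      · rw [hb₃ _ (by omega) (by omega) (by omega), if_neg hjq, hq₂ _ (by omega)]
        congr 1
        omega
  · rw [← hperm.mem_iff] at hx
    rw [Perm.mul_apply, List.formPerm_apply_of_notMem hx, List.formPerm_apply_of_notMem]
    rwa [(movedBlock_perm (by omega) hne).mem_iff]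

/-- A cycle of odd length has a cycle on the same points as its square root. -/
theorem exists_formPerm_eq_pow {l : List ℕ} (hl : l.Nodup) {r : ℕ}
    (hr : l.length + 1 = 2 * r) :
    l.formPerm ^ r * l.formPerm ^ r = l.formPerm ∧
      ∃ e : List ℕ, e.Perm l ∧ l.formPerm ^ r = e.formPerm := by
  have hsq : l.formPerm ^ r * l.formPerm ^ r = l.formPerm := by
    rw [← pow_add, ← two_mul, ← hr, pow_succ, List.formPerm_pow_length_eq_one_of_nodup _ hl,
      one_mul]
  refine ⟨hsq, ?_⟩
  rcases eq_or_ne l [] with rfl | hl0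
  · exact ⟨[], List.Perm.refl _, by simp⟩
  have hpos : 0 < l.length := List.length_pos_iff.2 hl0
  set π := l.formPerm ^ r with hπ
  have hpow : ∀ j, (π ^ j) l[0] ∈ l := by
    intro j
    rw [hπ, ← pow_mul, List.formPerm_pow_apply_getElem _ hl]
    exact List.getElem_mem _
  have hnd : (orbitList π l[0] l.length).Nodup := by
    refine List.Nodup.map_on ?_ List.nodup_range
    intro i hi j hj hij
    rw [List.mem_range] at hi hj
    -- Squaring carries a coincidence for the root over to the cycle itself.
    have h : (l.formPerm ^ i) l[0] = (l.formPerm ^ j) l[0] := by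
      have hcomm : Commute π π := Commute.refl π
      rw [← hsq, hcomm.mul_pow, hcomm.mul_pow, Perm.mul_apply, Perm.mul_apply, hij,
        ← Perm.mul_apply, ← Perm.mul_apply, ← pow_add, add_comm, pow_add, Perm.mul_apply, hij,
        Perm.mul_apply]
    rw [List.formPerm_pow_apply_getElem _ hl, List.formPerm_pow_apply_getElem _ hl,
      hl.getElem_inj_iff, Nat.zero_add, Nat.zero_add, Nat.mod_eq_of_lt hi, Nat.mod_eq_of_lt hj] at h
    exact h
  have hperm : (orbitList π l[0] l.length).Perm l := by
    refine (List.subperm_of_subset hnd fun x hx => ?_).perm_of_length_le (by simp)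
    obtain ⟨j, -, rfl⟩ := mem_orbitList.1 hx
    exact hpow j
  refine ⟨_, hperm, ?_⟩
  ext x
  by_cases hx : x ∈ l
  · refine apply_eq_formPerm_orbitList hnd ?_ (hperm.mem_iff.2 hx)
    rw [hπ, ← pow_mul, mul_comm, pow_mul, List.formPerm_pow_length_eq_one_of_nodup _ hl, one_pow,
      Perm.one_apply]
  · rw [List.formPerm_apply_of_notMem (hperm.mem_iff.not.2 hx), hπ]
    exact Perm.pow_apply_eq_self_of_apply_eq_self (List.formPerm_apply_of_notMem hx) r

/-! ### Subalgorithm C -/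

/-- `c` is a product of cycles that multiply to a single cycle through all points of the list `D`.
The bounds on the number and the total length of its members enter the running time. -/
structure IsFactor (D : List ℕ) (c : List (List ℕ)) : Prop where
  cycle : ∃ e : List ℕ, e.Perm D ∧ cyclesProd c = e.formPerm
  cycles : ∀ p ∈ c, p ≠ [] ∧ p.Nodup ∧ ∀ x ∈ p, x ∈ D
  length_lt : c.length < 2 * D.length
  length_flatten : c.flatten.length ≤ D.length ^ 2

theorem IsFactor.singleton {D p : List ℕ} (hD : D.Nodup) (hp : p.Perm D) (hne : D ≠ []) :
    IsFactor D [p] where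
  cycle := ⟨p, hp, by simp⟩
  cycles := fun q hq => by
    obtain rfl := List.mem_singleton.1 hq
    exact ⟨fun h => hne (by simpa [h] using hp), hp.nodup_iff.2 hD, fun x => hp.mem_iff.1⟩
  length_lt := by
    have := List.length_pos_iff.2 hne
    simp only [List.length_singleton]
    omega
  length_flatten := by
    simp only [List.flatten_singleton, hp.length_eq]
    exact Nat.le_self_pow two_ne_zero _

/-- The square root of a cycle of odd length, written as a repeated cycle. -/
theorem IsFactor.replicate {p : List ℕ} (hp : p.Nodup) {r : ℕ} (hr : p.length + 1 = 2 * r) :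
    IsFactor p (List.replicate r p) ∧
      cyclesProd (List.replicate r p) * cyclesProd (List.replicate r p) = p.formPerm := by
  obtain ⟨hsq, e, he, hpe⟩ := exists_formPerm_eq_pow hp hr
  have hprod : cyclesProd (List.replicate r p) = p.formPerm ^ r := by
    simp [cyclesProd]
  refine ⟨⟨⟨e, he, by rw [hprod, hpe]⟩, fun q hq => ?_, ?_, ?_⟩, by rw [hprod, hsq]⟩
  · obtain rfl := List.eq_of_mem_replicate hq
    refine ⟨?_, hp, fun _ => id⟩
    rintro rfl
    simp at hr
    omega
  · rw [List.length_replicate]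
    omega
  · -- The number of copies is at most the length of the cycle.
    simp only [List.length_flatten, List.map_replicate, List.sum_replicate, smul_eq_mul]
    rw [pow_two]
    exact Nat.mul_le_mul_right _ (by omega)

/-- The factors of a product of two disjoint permutations. -/
theorem IsFactor.join {D₁ D₂ : List ℕ} (h : (D₁ ++ D₂).Nodup) {c₁₁ c₁₂ c₂₁ c₂₂ : List (List ℕ)}
    (h₁₁ : IsFactor D₁ c₁₁) (h₁₂ : IsFactor D₁ c₁₂) (h₂₁ : IsFactor D₂ c₂₁)
    (h₂₂ : IsFactor D₂ c₂₂) {u v : ℕ} (hu : u ∈ D₁) (hv : v ∈ D₂) :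
    IsFactor (D₁ ++ D₂) (c₁₁ ++ (c₂₁ ++ [[u, v]])) ∧
      IsFactor (D₁ ++ D₂) ([u, v] :: (c₁₂ ++ c₂₂)) ∧
      cyclesProd (c₁₁ ++ (c₂₁ ++ [[u, v]])) * cyclesProd ([u, v] :: (c₁₂ ++ c₂₂)) =
        cyclesProd c₁₁ * cyclesProd c₁₂ * (cyclesProd c₂₁ * cyclesProd c₂₂) := by
  have hpos₁ := List.length_pos_of_mem hu
  have hpos₂ := List.length_pos_of_mem hv
  have huv : u ≠ v := fun e => (List.nodup_append'.1 h).2.2 hu (e ▸ hv)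
  have hsq : D₁.length ^ 2 + D₂.length ^ 2 + 2 ≤ (D₁.length + D₂.length) ^ 2 := by
    have := Nat.mul_le_mul hpos₁ hpos₂
    nlinarith
  have hpair : [u, v] ≠ [] ∧ [u, v].Nodup ∧ ∀ x ∈ [u, v], x ∈ D₁ ++ D₂ := by
    refine ⟨by simp, by simpa using huv, ?_⟩
    simp only [List.mem_cons, List.not_mem_nil, or_false, List.mem_append]
    rintro x (rfl | rfl)
    exacts [Or.inl hu, Or.inr hv]
  have hleft : ∀ {c}, IsFactor D₁ c → ∀ p ∈ c, p ≠ [] ∧ p.Nodup ∧ ∀ x ∈ p, x ∈ D₁ ++ D₂ :=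
    fun hc p hp => ⟨(hc.cycles p hp).1, (hc.cycles p hp).2.1, fun x hx =>
      List.mem_append_left _ ((hc.cycles p hp).2.2 x hx)⟩
  have hright : ∀ {c}, IsFactor D₂ c → ∀ p ∈ c, p ≠ [] ∧ p.Nodup ∧ ∀ x ∈ p, x ∈ D₁ ++ D₂ :=
    fun hc p hp => ⟨(hc.cycles p hp).1, (hc.cycles p hp).2.1, fun x hx =>
      List.mem_append_right _ ((hc.cycles p hp).2.2 x hx)⟩
  have hcycle : ∀ {e₁ e₂ : List ℕ}, e₁.Perm D₁ → e₂.Perm D₂ →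
      (e₁ ++ e₂).Nodup ∧ u ∈ e₁ ∧ v ∈ e₂ := fun he₁ he₂ =>
    ⟨(he₁.append he₂).nodup_iff.2 h, he₁.mem_iff.2 hu, he₂.mem_iff.2 hv⟩
  obtain ⟨e₁₁, he₁₁, hp₁₁⟩ := h₁₁.cycle
  obtain ⟨e₁₂, he₁₂, hp₁₂⟩ := h₁₂.cycle
  obtain ⟨e₂₁, he₂₁, hp₂₁⟩ := h₂₁.cycle
  obtain ⟨e₂₂, he₂₂, hp₂₂⟩ := h₂₂.cycle
  have l₁₁ := h₁₁.length_lt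
  have l₁₂ := h₁₂.length_lt
  have l₂₁ := h₂₁.length_lt
  have l₂₂ := h₂₂.length_lt
  have f₁₁ := h₁₁.length_flatten
  have f₁₂ := h₁₂.length_flatten
  have f₂₁ := h₂₁.length_flatten
  have f₂₂ := h₂₂.length_flatten
  refine ⟨⟨?_, ?_, ?_, ?_⟩, ⟨?_, ?_, ?_, ?_⟩, ?_⟩
  · obtain ⟨hn, hu', hv'⟩ := hcycle he₁₁ he₂₁
    obtain ⟨e, he, h'⟩ := exists_formPerm_mul_swap hn hu' hv'
    refine ⟨e, he.trans (he₁₁.append he₂₁), ?_⟩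
    simp only [cyclesProd_append, cyclesProd_cons, cyclesProd_nil, List.formPerm_pair, mul_one]
    rw [hp₁₁, hp₂₁, ← h', mul_assoc]
  · intro p hp
    simp only [List.mem_append, List.mem_singleton] at hp
    rcases hp with hp | hp | rfl
    exacts [hleft h₁₁ p hp, hright h₂₁ p hp, hpair]
  · simp only [List.length_append, List.length_singleton]
    omega
  · simp only [List.flatten_append, List.flatten_singleton, List.length_append, List.length_cons,
      List.length_nil]
    omega
  · obtain ⟨hn, hu', hv'⟩ := hcycle he₁₂ he₂₂
    obtain ⟨e, he, h'⟩ := exists_swap_mul_formPerm hn hu' hv'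
    refine ⟨e, he.trans (he₁₂.append he₂₂), ?_⟩
    simp only [cyclesProd_append, cyclesProd_cons, List.formPerm_pair]
    rw [hp₁₂, hp₂₂, ← h', mul_assoc]
  · intro p hp
    simp only [List.mem_append, List.mem_cons] at hp
    rcases hp with rfl | hp | hp
    exacts [hpair, hleft h₁₂ p hp, hright h₂₂ p hp]
  · simp only [List.length_append, List.length_cons]
    omega
  · simp only [List.flatten_append, List.flatten_cons, List.length_append, List.length_cons,
      List.length_nil]
    omega
  · have hcomm : Commute (cyclesProd c₂₁) (cyclesProd c₁₂) := by
      rw [hp₂₁, hp₁₂]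
      refine (disjoint_formPerm fun x hx hx' => ?_).commute
      exact (List.nodup_append'.1 h).2.2 (he₁₂.mem_iff.1 hx') (he₂₁.mem_iff.1 hx)
    simp only [cyclesProd_append, cyclesProd_cons, cyclesProd_nil, List.formPerm_pair, mul_one]
    calc _ = cyclesProd c₁₁ * (cyclesProd c₂₁ * (swap u v * swap u v) * cyclesProd c₁₂) *
          cyclesProd c₂₂ := by simp only [mul_assoc]
      _ = _ := by
        rw [Equiv.swap_mul_self, mul_one, hcomm.eq]
        simp only [mul_assoc]

theorem computes_joinPairs (u v : ℕ) (c₁₁ c₁₂ c₂₁ c₂₂ : List (List ℕ)) :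
    Computes (joinPairs u v c₁₁ c₁₂ c₂₁ c₂₂)
      (c₁₁ ++ (c₂₁ ++ [[u, v]]), [u, v] :: (c₁₂ ++ c₂₂))
      (2 * (c₁₁.length + c₁₂.length + c₂₁.length) + 5) := by
  refine .mono ((computes_append _ _).bind ((computes_append _ _).bind ((computes_append _ _).bind
    (Computes.op_bind (.op _))))) ?_
  omega

theorem computes_equalPair (p q : List ℕ) :
    Computes (equalPair p q) ([interleaved p q], [interleaved p q]) (2 * p.length + 4) :=
  .mono ((computes_interleave p q).bind (Computes.op_bind (Computes.op_bind (.op _)))) (by omega)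

theorem computes_unequalPair {p q : List ℕ} (hp : 1 ≤ p.length) (hlt : p.length < q.length) {m : ℕ}
    (hm : p.length + q.length = 2 * m) :
    Computes (unequalPair p q p.length q.length)
      ([movedBlock (2 * p.length) (interleaved (p ++ q.drop m) (q.take m))],
        [interleaved (p ++ q.drop m) (q.take m)]) (14 * m + 10) := by
  have hl : (p ++ q.drop m).length = (q.take m).length := by simp; omega
  have hlen := length_interleaved hl
  simp only [List.length_append, List.length_drop] at hlen
  have hdiv : (p.length + q.length) / 2 = m := by omega
  have hblock : ∀ i : List ℕ, movedBlock (2 * p.length) i =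
      (i.take (2 * p.length)).headD 0 ::
        (i.drop (2 * p.length) ++ (i.take (2 * p.length)).tail) := fun i => by
    obtain ⟨b, hb⟩ := Nat.exists_eq_add_of_le' (show 1 ≤ 2 * p.length by omega)
    rw [hb]
    cases i <;> rfl
  unfold unequalPair
  rw [hdiv, hblock]
  refine .mono (Computes.op_bind ((computes_cut _ _).bind ((computes_append _ _).bind
    ((computes_interleave _ _).bind ((computes_cut _ _).bind ((computes_append _ _).bind
    (Computes.op_bind (Computes.op_bind (.op _))))))))) ?_
  simp only [List.length_append, List.length_drop, hlen]
  omega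

theorem computes_peelOdd (d : List (List ℕ)) :
    ∃ r, Computes (peelOdd d) r (2 * d.flatten.length + 6 * d.length + 1) ∧
      ((r = none ∧ ∀ c ∈ d, c.length % 2 = 0) ∨
        ∃ c d', r = some (c, d') ∧ c.length % 2 = 1 ∧ d.Perm (c :: d')) := by
  induction d with
  | nil => exact ⟨none, .op _, Or.inl (by simp)⟩
  | cons c d ih =>
    by_cases hc : c.length % 2 = 1
    · refine ⟨some (c, d), ?_, Or.inr ⟨c, d, rfl, hc, List.Perm.refl _⟩⟩
      refine .mono (Computes.tick_bind ((computes_size c).bind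
        (Computes.test_true (by simpa using hc) (.op _)))) ?_
      simp only [List.flatten_cons, List.length_append, List.length_cons]
      omega
    · obtain ⟨r, hr, ⟨rfl, h⟩ | ⟨c', d', rfl, hc', h⟩⟩ := ih
      · refine ⟨none, ?_, Or.inl ⟨rfl, ?_⟩⟩
        · refine .mono (Computes.tick_bind ((computes_size c).bind
            (Computes.test_false (by simpa using hc) (hr.bind (.op _))))) ?_
          simp only [List.flatten_cons, List.length_append, List.length_cons]
          omega
        · intro c' hc'
          rcases List.mem_cons.1 hc' with rfl | hc'
          · omega
          · exact h c' hc'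
      · refine ⟨some (c', c :: d'), ?_, Or.inr ⟨c', c :: d', rfl, hc', ?_⟩⟩
        · refine .mono (Computes.tick_bind ((computes_size c).bind
            (Computes.test_false (by simpa using hc) (hr.bind (.op _))))) ?_
          simp only [List.flatten_cons, List.length_append, List.length_cons]
          omega
        · exact (h.cons c).trans (List.Perm.swap _ _ _)

theorem cyclesProd_eq_of_perm {d d' : List (List ℕ)} (h : d.Perm d') (hd : d.flatten.Nodup) :
    cyclesProd d = cyclesProd d' := by
  refine (h.map _).prod_eq' ?_
  rw [List.pairwise_map]
  exact (List.nodup_flatten.1 hd).2.imp fun h => (disjoint_formPerm h).commute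

theorem length_le_length_flatten {d : List (List ℕ)} (hd : ∀ c ∈ d, c ≠ []) :
    d.length ≤ d.flatten.length := by
  induction d with
  | nil => simp
  | cons c d ih =>
    have := List.length_pos_iff.2 (hd c List.mem_cons_self)
    have := ih fun c' hc' => hd c' (List.mem_cons_of_mem _ hc')
    simp only [List.flatten_cons, List.length_append, List.length_cons]
    omega

/-- The list `d` is the cycle decomposition of an even permutation of a finite nonempty set of
points; evenness is stated through the sign `(-1) ^ (l + 1)` of a cycle of length `l`. -/
structure IsEvenDecomp (d : List (List ℕ)) : Prop where
  ne_nil : d ≠ []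
  cycles : ∀ c ∈ d, c ≠ []
  nodup : d.flatten.Nodup
  even : Even (d.flatten.length + d.length)

/-- Within time `T`, `subC` writes the permutation with the decomposition `d` as a product of two
cycles through all its points. -/
def SubCFactors (d : List (List ℕ)) (T : ℕ) : Prop :=
  ∃ c₁ c₂, Computes (subC d d.flatten.length) (c₁, c₂) T ∧ IsFactor d.flatten c₁ ∧
    IsFactor d.flatten c₂ ∧ cyclesProd c₁ * cyclesProd c₂ = cyclesProd d

theorem IsFactor.of_perm {D D' : List ℕ} {c : List (List ℕ)} (h : IsFactor D c)
    (hD : D.Perm D') : IsFactor D' c where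
  cycle := let ⟨e, he, h'⟩ := h.cycle; ⟨e, he.trans hD, h'⟩
  cycles := fun p hp => ⟨(h.cycles p hp).1, (h.cycles p hp).2.1, fun x hx =>
    hD.mem_iff.1 ((h.cycles p hp).2.2 x hx)⟩
  length_lt := hD.length_eq ▸ h.length_lt
  length_flatten := hD.length_eq ▸ h.length_flatten

/-- A single cycle of odd length. -/
theorem subCFactors_singleton {p : List ℕ} (h : IsEvenDecomp [p]) :
    SubCFactors [p] (100 * p.length ^ 2) := by
  have heven := h.even
  simp only [List.flatten_singleton, List.length_singleton] at heven
  obtain ⟨r, hr⟩ := heven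
  have hdiv : (p.length + 1) / 2 = r := by omega
  obtain ⟨hf, hprod⟩ := IsFactor.replicate (p := p) (by simpa using h.nodup) (r := r) (by omega)
  refine ⟨_, _, ?_, by simpa using hf, by simpa using hf, by simpa using hprod⟩
  rw [subC, List.flatten_singleton, ← hdiv]
  refine .mono (Computes.tick_bind ((computes_size _).bind (Computes.op_bind (Computes.op_bind
    ((computes_size _).bind ((computes_size _).bind (Computes.test_true ?_
    (((computes_copies _ _).bind (.op _)))))))))) ?_
  · simp
    omega
  · have := Nat.le_self_pow two_ne_zero p.length
    simp
    omega

theorem exists_computes_unequalPair {p q : List ℕ} (h : (p ++ q).Nodup) (hp : 1 ≤ p.length)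
    (hlt : p.length < q.length) {m : ℕ} (hm : p.length + q.length = 2 * m) :
    ∃ c₁ c₂, Computes (unequalPair p q p.length q.length) (c₁, c₂) (14 * m + 10) ∧
      IsFactor (p ++ q) c₁ ∧ IsFactor (p ++ q) c₂ ∧
      cyclesProd c₁ * cyclesProd c₂ = p.formPerm * q.formPerm := by
  have hlen : (p ++ q.drop m).length = (q.take m).length := by simp; omega
  have hperm : (interleaved (p ++ q.drop m) (q.take m)).Perm (p ++ q) := by
    refine (interleaved_perm hlen).trans ?_
    rw [List.append_assoc]
    refine List.Perm.append_left _ (List.perm_append_comm.trans ?_)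
    rw [List.take_append_drop]
  have hne : p ++ q ≠ [] := by
    intro h'
    rw [(List.append_eq_nil_iff.1 h').1] at hp
    simp at hp
  have hne' : interleaved (p ++ q.drop m) (q.take m) ≠ [] := fun h' => hne (by
    rw [h'] at hperm
    exact hperm.symm.eq_nil)
  refine ⟨_, _, computes_unequalPair hp hlt hm,
    IsFactor.singleton h ((movedBlock_perm (by omega) hne').trans hperm) hne,
    IsFactor.singleton h hperm hne, ?_⟩
  simp only [cyclesProd_cons, cyclesProd_nil, mul_one]
  exact formPerm_movedBlock_mul h hp hlt hm

/-- Two cycles of even length. -/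
theorem subCFactors_pair {p q : List ℕ} (h : IsEvenDecomp [p, q]) (hp : p.length % 2 = 0) :
    SubCFactors [p, q] (100 * (p.length + q.length) ^ 2) := by
  have hpos : 1 ≤ p.length := List.length_pos_iff.2 (h.cycles p (by simp))
  have hpos' : 1 ≤ q.length := List.length_pos_iff.2 (h.cycles q (by simp))
  have hflat : [p, q].flatten = p ++ q := by simp
  have hnd := h.nodup
  have heven := h.even
  simp only [hflat, List.length_append, List.length_cons, List.length_nil] at hnd heven
  have hq : q.length % 2 = 0 := by
    rw [Nat.even_iff] at heven
    omega
  have hprod : cyclesProd [p, q] = p.formPerm * q.formPerm := by simp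
  have hsq := Nat.le_self_pow two_ne_zero (p.length + q.length)
  have hne : p ++ q ≠ [] := by
    intro h'
    rw [(List.append_eq_nil_iff.1 h').1] at hpos
    simp at hpos
  unfold SubCFactors
  rw [hflat, hprod, subC, List.length_append]
  rcases eq_or_ne p.length q.length with hl | hl
  · have hf := IsFactor.singleton hnd (interleaved_perm hl) hne
    refine ⟨_, _, ?_, hf, hf, by simpa using formPerm_interleaved_mul_self hnd hl⟩
    refine .mono (Computes.tick_bind ((computes_size _).bind (Computes.op_bind (Computes.op_bind
      ((computes_size _).bind ((computes_size _).bind (Computes.test_false (by simp)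
      (Computes.test_true (by simp [hl, hq]) (computes_equalPair p q))))))))) ?_
    simp
    omega
  · obtain ⟨m, hm⟩ : ∃ m, p.length + q.length = 2 * m := ⟨(p.length + q.length) / 2, by omega⟩
    rcases Nat.lt_or_ge p.length q.length with hlt | hge
    · obtain ⟨c₁, c₂, hcomp, hf₁, hf₂, hmul⟩ := exists_computes_unequalPair hnd hpos hlt hm
      refine ⟨c₁, c₂, ?_, hf₁, hf₂, hmul⟩
      refine .mono (Computes.tick_bind ((computes_size _).bind (Computes.op_bind (Computes.op_bind
        ((computes_size _).bind ((computes_size _).bind (Computes.test_false (by simp)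
        (Computes.test_false (by simp [hl]) (Computes.test_true (by simp [hp, hq])
        (Computes.test_true (by simpa using hlt) hcomp)))))))))) ?_
      simp
      omega
    · -- The shorter cycle is moved to the front; disjoint cycles commute.
      obtain ⟨c₁, c₂, hcomp, hf₁, hf₂, hmul⟩ := exists_computes_unequalPair
        (List.nodup_append_comm.1 hnd) hpos' (by omega) ((add_comm _ _).trans hm)
      have hcomm : Commute p.formPerm q.formPerm :=
        (disjoint_formPerm (List.nodup_append'.1 hnd).2.2).commute
      refine ⟨c₁, c₂, ?_, hf₁.of_perm List.perm_append_comm, hf₂.of_perm List.perm_append_comm,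
        hmul.trans hcomm.eq.symm⟩
      refine .mono (Computes.tick_bind ((computes_size _).bind (Computes.op_bind (Computes.op_bind
        ((computes_size _).bind ((computes_size _).bind (Computes.test_false (by simp)
        (Computes.test_false (by simp [hl]) (Computes.test_true (by simp [hp, hq])
        (Computes.test_false (by simpa using hge) hcomp)))))))))) ?_
      simp
      omega

theorem sq_add_sq_add_le {a b : ℕ} (ha : 1 ≤ a) (hb : 1 ≤ b) :
    a ^ 2 + b ^ 2 + (a + b) ≤ (a + b) ^ 2 := by
  obtain ⟨a, rfl⟩ := Nat.exists_eq_add_of_le' ha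
  obtain ⟨b, rfl⟩ := Nat.exists_eq_add_of_le' hb
  nlinarith [Nat.zero_le (a * b)]

/-- A decomposition with a further cycle or with a cycle of odd length is split, and its parts are
factored separately. -/
theorem subCFactors_split {p q : List ℕ} {d : List (List ℕ)} (h : IsEvenDecomp (p :: q :: d))
    (hd : d ≠ [] ∨ p.length % 2 = 1)
    (ih : ∀ d' : List (List ℕ), d'.length < (p :: q :: d).length → IsEvenDecomp d' →
      SubCFactors d' (100 * d'.flatten.length ^ 2)) :
    SubCFactors (p :: q :: d) (100 * (p :: q :: d).flatten.length ^ 2) := by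
  have hm := length_le_length_flatten h.cycles
  have hab : p.length + q.length ≤ (p :: q :: d).flatten.length := by simp
  have heven := h.even
  have ht₁ : ((p :: q :: d).length == 1 && (p :: q :: d).flatten.length % 2 == 1) = false := by
    simp
  have ht₂ : ((p :: q :: d).length == 2 && p.length % 2 == 0 && p.length == q.length) = false := by
    rcases hd with hd | hd <;> simp [hd]
  have ht₃ : ((p :: q :: d).length == 2 && p.length % 2 == 0 && q.length % 2 == 0) = false := by
    rcases hd with hd | hd <;> simp [hd]
  unfold SubCFactors
  rw [subC]
  obtain ⟨r, hr, ⟨rfl, hall⟩ | ⟨c, d', rfl, hc, hperm⟩⟩ := computes_peelOdd (p :: q :: d)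
  · have heven_d : ∀ d' : List (List ℕ), (∀ c ∈ d', c.length % 2 = 0) →
        d'.flatten.length % 2 = 0 := by
      intro d' hd'
      induction d' with
      | nil => simp
      | cons c d' ihd =>
        have h₁ := hd' c List.mem_cons_self
        have h₂ := ihd fun c' hc' => hd' c' (List.mem_cons_of_mem _ hc')
        simp only [List.flatten_cons, List.length_append]
        omega
    have hp := hall p (by simp)
    have hq := hall q (by simp)
    have hde := heven_d d fun c hc => hall c (by simp [hc])
    -- Without odd cycles the number of cycles is even, so that two of them and an even rest remain.
    have hdne : d ≠ [] := hd.resolve_right (by omega)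
    have hnd := h.nodup
    rw [show p :: q :: d = [p, q] ++ d from rfl, List.flatten_append] at hnd
    have hflat : [p, q].flatten = p ++ q := by simp
    have h₁ : IsEvenDecomp [p, q] := by
      refine ⟨by simp, fun c hc => h.cycles c (by simp at hc ⊢; tauto),
        (List.nodup_append'.1 hnd).1, ?_⟩
      rw [hflat, Nat.even_iff, List.length_append]
      simp only [List.length_cons, List.length_nil]
      omega
    have h₂ : IsEvenDecomp d := by
      refine ⟨hdne, fun c hc => h.cycles c (by simp [hc]), (List.nodup_append'.1 hnd).2.1, ?_⟩
      rw [Nat.even_iff] at heven ⊢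
      simp only [List.flatten_cons, List.length_append, List.length_cons] at heven
      omega
    have hdpos := List.length_pos_iff.2 hdne
    obtain ⟨c₁₁, c₁₂, hcomp₁, hf₁₁, hf₁₂, hprod₁⟩ := ih [p, q] (by simp; omega) h₁
    obtain ⟨c₂₁, c₂₂, hcomp₂, hf₂₁, hf₂₂, hprod₂⟩ := ih d (by simp) h₂
    have hm₁ := length_le_length_flatten h₁.cycles
    have hm₂ := length_le_length_flatten h₂.cycles
    have hne₁ : [p, q].flatten ≠ [] := fun e => by simp [e] at hm₁
    have hne₂ : d.flatten ≠ [] := fun e => by rw [e, List.length_nil] at hm₂; omega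
    obtain ⟨hF₁, hF₂, hprod⟩ := IsFactor.join hnd hf₁₁ hf₁₂ hf₂₁ hf₂₂ (foldr_max_mem hne₁)
      (foldr_max_mem hne₂)
    rw [hprod₁, hprod₂, ← cyclesProd_append [p, q] d] at hprod
    have hflat' : (p :: q :: d).flatten = [p, q].flatten ++ d.flatten := by simp
    rw [← hflat'] at hF₁ hF₂
    refine ⟨_, _, ?_, hF₁, hF₂, hprod⟩
    have hlen : (p :: q :: d).flatten.length = [p, q].flatten.length + d.flatten.length := by
      rw [hflat', List.length_append]
    have hn₁ : [p, q].flatten.length = p.length + q.length := by simp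
    have hn₂ : (p :: q :: d).flatten.length - (p.length + q.length) = d.flatten.length := by
      omega
    rw [hn₁] at hcomp₁
    rw [← hn₂] at hcomp₂
    refine .mono (Computes.tick_bind ((computes_size _).bind (Computes.op_bind (Computes.op_bind
      ((computes_size _).bind ((computes_size _).bind (Computes.test_false ht₁
      (Computes.test_false ht₂ (Computes.test_false ht₃ (hr.bind (Computes.op_bind
      (Computes.op_bind (Computes.op_bind (hcomp₁.bind (hcomp₂.bind ((computes_maxOfCycles _).bind
      ((computes_maxOfCycles _).bind (computes_joinPairs _ _ _ _ _ _)))))))))))))))))) ?_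
    have hpos₁ : 1 ≤ [p, q].flatten.length := List.length_pos_iff.2 hne₁
    have hpos₂ : 1 ≤ d.flatten.length := List.length_pos_iff.2 hne₂
    have l₁₁ := hf₁₁.length_lt
    have l₁₂ := hf₁₂.length_lt
    have l₂₁ := hf₂₁.length_lt
    have hsq := sq_add_sq_add_le hpos₁ hpos₂
    have e₁ : (List.getD (p :: q :: d) 0 []).length = p.length := rfl
    have e₂ : (List.getD (p :: q :: d) 1 []).length = q.length := rfl
    have e₃ : (List.drop 2 (p :: q :: d)) = d := rfl
    have e₄ : [(p :: q :: d).getD 0 [], (p :: q :: d).getD 1 []] = [p, q] := rfl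
    simp only [e₁, e₂, e₃, e₄, hlen, List.length_cons, List.length_nil, hn₁,
      Nat.add_sub_cancel_left] at *
    omega
  · have hnd := hperm.flatten.nodup_iff.1 h.nodup
    rw [List.flatten_cons] at hnd
    have hplen := hperm.length_eq
    have hflen := hperm.flatten.length_eq
    simp only [List.flatten_cons, List.length_append, List.length_cons] at hplen hflen
    have hd' : IsEvenDecomp d' := by
      refine ⟨?_, fun c' hc' => h.cycles c' (hperm.mem_iff.2 (List.mem_cons_of_mem _ hc')),
        (List.nodup_append'.1 hnd).2.1, ?_⟩
      · rintro rfl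
        simp at hplen
      · rw [Nat.even_iff] at heven ⊢
        simp only [List.flatten_cons, List.length_append, List.length_cons] at heven
        omega
    obtain ⟨c₂₁, c₂₂, hcomp, hf₂₁, hf₂₂, hprod₂⟩ := ih d' (by simp; omega) hd'
    obtain ⟨k, hk⟩ : ∃ k, c.length + 1 = 2 * k := ⟨(c.length + 1) / 2, by omega⟩
    obtain ⟨hf₁, hprod₁⟩ := IsFactor.replicate (List.nodup_append'.1 hnd).1 hk
    have hm₂ := length_le_length_flatten hd'.cycles
    have hne₁ : c ≠ [] := fun e => by simp [e] at hc
    have hne₂ : d'.flatten ≠ [] := fun e => by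
      rw [e, List.length_nil] at hm₂
      omega
    obtain ⟨hF₁, hF₂, hprod⟩ := IsFactor.join hnd hf₁ hf₁ hf₂₁ hf₂₂ (foldr_max_mem hne₁)
      (foldr_max_mem hne₂)
    rw [hprod₁, hprod₂, ← cyclesProd_cons, ← cyclesProd_eq_of_perm hperm h.nodup] at hprod
    rw [← List.flatten_cons] at hF₁ hF₂
    refine ⟨_, _, ?_, hF₁.of_perm hperm.flatten.symm, hF₂.of_perm hperm.flatten.symm, hprod⟩
    have hdiv : (c.length + 1) / 2 = k := by omega
    have hn₂ : (p :: q :: d).flatten.length - c.length = d'.flatten.length := by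
      simp only [List.flatten_cons, List.length_append]
      omega
    rw [← hn₂] at hcomp
    rw [← hdiv]
    refine .mono (Computes.tick_bind ((computes_size _).bind (Computes.op_bind (Computes.op_bind
      ((computes_size _).bind ((computes_size _).bind (Computes.test_false ht₁
      (Computes.test_false ht₂ (Computes.test_false ht₃ (hr.bind ((computes_size _).bind
      ((computes_copies _ _).bind (Computes.op_bind (hcomp.bind ((computes_maxOf _).bind
      ((computes_maxOfCycles _).bind (computes_joinPairs _ _ _ _ _ _))))))))))))))))) ?_
    have hpos₁ : 1 ≤ c.length := List.length_pos_iff.2 hne₁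
    have hpos₂ : 1 ≤ d'.flatten.length := List.length_pos_iff.2 hne₂
    have l₁ := hf₁.length_lt
    have l₂₁ := hf₂₁.length_lt
    have hsq := sq_add_sq_add_le hpos₁ hpos₂
    have e₁ : (List.getD (p :: q :: d) 0 []).length = p.length := rfl
    have e₂ : (List.getD (p :: q :: d) 1 []).length = q.length := rfl
    simp only [e₁, e₂, hdiv, List.length_cons, List.length_replicate, List.flatten_cons,
      List.length_append, hflen, Nat.add_sub_cancel_left] at *
    omega

/-- The factorization takes quadratic time, even though every step of the recursion is linear,
because each step splits off at least one point. -/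
theorem subCFactors {d : List (List ℕ)} (h : IsEvenDecomp d) :
    SubCFactors d (100 * d.flatten.length ^ 2) := by
  induction hl : d.length using Nat.strong_induction_on generalizing d with
  | _ l ih =>
    obtain _ | ⟨p, _ | ⟨q, d⟩⟩ := d
    · exact absurd rfl h.ne_nil
    · simpa using subCFactors_singleton h
    · by_cases hd : d ≠ [] ∨ p.length % 2 = 1
      · exact subCFactors_split h hd fun d' hd' h' => ih _ (hl ▸ hd') h' rfl
      · push Not at hd
        obtain ⟨rfl, hp⟩ := hd
        simpa using subCFactors_pair h (by omega)

/-! ### Subalgorithm F -/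

theorem computes_subFUp (w : List ℕ) (c t m : ℕ) :
    Computes (subFUp w c t (t + m)) (w ++ List.range' t m, c + m) (4 * m + 2) := by
  induction m generalizing w c t with
  | zero =>
    rw [subFUp]
    simpa using Computes.test_false (by simp) (.op (w, c))
  | succ m ih =>
    have h := ih (w ++ [t]) (c + 1) (t + 1)
    rw [List.append_assoc, List.singleton_append, ← List.range'_succ,
      show t + 1 + m = t + (m + 1) by omega, show c + 1 + m = c + (m + 1) by omega] at h
    rw [subFUp]
    refine .mono (Computes.test_true (by simp) (Computes.op_bind (Computes.op_bind
      (Computes.op_bind h)))) ?_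
    omega

theorem computes_subFDown (w : List ℕ) {a c : ℕ} (h : a + c ≤ w.length) :
    Computes (subFDown w a c) (w ++ ((w.drop a).take c).reverse) (2 * c + 1) := by
  induction c generalizing w with
  | zero => simpa [subFDown] using Computes.op w
  | succ c ih =>
    have h' := ih (w ++ [w.getD (a + c) 0]) (by simp; omega)
    have e₁ : ((w ++ [w.getD (a + c) 0]).drop a).take c = (w.drop a).take c := by
      rw [List.drop_append_of_le_length (by omega), List.take_append_of_le_length (by simp; omega)]
    have e₂ : ((w.drop a).take (c + 1)).reverse =
        w.getD (a + c) 0 :: ((w.drop a).take c).reverse := by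
      rw [List.take_succ_eq_append_getElem (by simp; omega), List.reverse_append,
        List.getElem_drop, List.getD_eq_getElem _ _ (by omega)]
      rfl
    rw [e₁, List.append_assoc, List.singleton_append, ← e₂] at h'
    exact .mono (Computes.tick_bind (Computes.op_bind h')) (by omega)

/-- The letters of the transposition of `s` and `e`: up from the smaller point to the larger one and
back. -/
def swapWord (s e : ℕ) : List ℕ :=
  List.range' (min s e) (max s e - min s e) ++
    (List.range' (min s e) (max s e - min s e - 1)).reverse

/-- Walking from `t` to `t + k + 1` and back conjugates the last transposition by the others. -/
theorem natPerm_range' (t k : ℕ) :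
    natPerm (List.range' t (k + 1) ++ (List.range' t k).reverse) = swap t (t + k + 1) := by
  induction k generalizing t with
  | zero => simp
  | succ k ih =>
    have h := Equiv.swap_apply_apply (swap t (t + 1)) (t + 1) (t + 1 + k + 1)
    rw [Equiv.swap_apply_right, Equiv.swap_apply_of_ne_of_ne (by omega) (by omega), ← ih (t + 1),
      Equiv.swap_inv] at h
    rw [List.range'_succ (s := t) (n := k + 1), List.range'_succ (s := t) (n := k),
      List.reverse_cons, show t + (k + 1) + 1 = t + 1 + k + 1 by omega, h]
    simp [mul_assoc]

theorem natPerm_reverse_swapWord {s e : ℕ} (h : s ≠ e) :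
    natPerm (swapWord s e).reverse = swap s e := by
  obtain ⟨k, hk⟩ : ∃ k, max s e - min s e = k + 1 := ⟨max s e - min s e - 1, by omega⟩
  rw [natPerm_reverse, swapWord, hk, Nat.add_sub_cancel, natPerm_range', Equiv.swap_inv,
    show min s e + k + 1 = max s e by omega]
  rcases le_total s e with h' | h'
  · rw [min_eq_left h', max_eq_right h']
  · rw [min_eq_right h', max_eq_left h', Equiv.swap_comm]

theorem length_swapWord_le {n s e : ℕ} (hs : 1 ≤ s ∧ s ≤ n) (he : 1 ≤ e ∧ e ≤ n) :
    (swapWord s e).length ≤ 2 * n := by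
  simp only [swapWord, List.length_append, List.length_reverse, List.length_range']
  omega

theorem isWord_swapWord {n s e : ℕ} (hs : 1 ≤ s ∧ s ≤ n) (he : 1 ≤ e ∧ e ≤ n) :
    IsWord n (swapWord s e) := by
  intro i hi
  simp only [swapWord, List.mem_append, List.mem_reverse, List.mem_range'_1] at hi
  omega

theorem computes_subFSwap (w : List ℕ) {n s e : ℕ} (hs : 1 ≤ s ∧ s ≤ n) (he : 1 ≤ e ∧ e ≤ n) :
    Computes (subFSwap w s e) (w ++ swapWord s e) (6 * n + 7) := by
  obtain ⟨m, hm⟩ : ∃ m, max s e = min s e + m := ⟨max s e - min s e, by omega⟩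
  have hup := computes_subFUp w 0 (min s e) m
  have hdown := computes_subFDown (w ++ List.range' (min s e) m) (a := w.length) (c := 0 + m - 1)
    (by simp)
  rw [Nat.zero_add] at hup hdown
  rw [List.drop_left, List.take_range'_of_length_ge (by omega), List.append_assoc] at hdown
  rw [swapWord, hm, Nat.add_sub_cancel_left]
  rw [← hm] at hup
  refine .mono (Computes.op_bind (Computes.op_bind (Computes.op_bind (hup.bind
    (Computes.op_bind hdown))))) ?_
  omega

/-- The letters of a cycle with first point `s` and further points `l`. -/
def cycleWord (s : ℕ) (l : List ℕ) : List ℕ := (l.map (swapWord s)).flatten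

theorem cycleWord_cons (s e : ℕ) (l : List ℕ) :
    cycleWord s (e :: l) = swapWord s e ++ cycleWord s l := by simp [cycleWord]

theorem natPerm_reverse_cycleWord {s : ℕ} {l : List ℕ} (h : (s :: l).Nodup) :
    natPerm (cycleWord s l).reverse = (s :: l).formPerm := by
  induction l with
  | nil => simp [cycleWord]
  | cons e l ih =>
    have hse : s ≠ e := fun h' => by simp [h'] at h
    rw [cycleWord_cons, List.reverse_append, natPerm_append, ih (h.sublist (by simp)),
      natPerm_reverse_swapWord hse, formPerm_cons_cons_right h]

theorem isWord_append {n : ℕ} {v w : List ℕ} (hv : IsWord n v) (hw : IsWord n w) :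
    IsWord n (v ++ w) := fun i hi => (List.mem_append.1 hi).elim (hv i) (hw i)

theorem cycleWord_bounds {n s : ℕ} (hs : 1 ≤ s ∧ s ≤ n) {l : List ℕ}
    (hl : ∀ x ∈ l, 1 ≤ x ∧ x ≤ n) :
    IsWord n (cycleWord s l) ∧ (cycleWord s l).length ≤ l.length * (2 * n) := by
  induction l with
  | nil => simp [cycleWord, IsWord]
  | cons e l ih =>
    have he := hl e List.mem_cons_self
    obtain ⟨h₁, h₂⟩ := ih fun x hx => hl x (List.mem_cons_of_mem _ hx)
    have h₃ := length_swapWord_le hs he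
    refine ⟨cycleWord_cons s e l ▸ isWord_append (isWord_swapWord hs he) h₁, ?_⟩
    simp only [cycleWord_cons, List.length_append, List.length_cons, add_mul]
    omega

theorem computes_subFCycle (w : List ℕ) {n s : ℕ} (hs : 1 ≤ s ∧ s ≤ n) {l : List ℕ}
    (hl : ∀ x ∈ l, 1 ≤ x ∧ x ≤ n) :
    Computes (subFCycle w s l) (w ++ cycleWord s l) (l.length * (6 * n + 8) + 1) := by
  induction l generalizing w with
  | nil => simpa [subFCycle, cycleWord] using Computes.op w
  | cons e l ih =>
    have he := hl e List.mem_cons_self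
    have h := ih (w ++ swapWord s e) fun x hx => hl x (List.mem_cons_of_mem _ hx)
    rw [List.append_assoc, ← cycleWord_cons] at h
    refine .mono (Computes.tick_bind ((computes_subFSwap w hs he).bind h)) ?_
    simp only [List.length_cons, add_mul]
    omega

/-- The letters of a product of cycles, starting with the cycle that is written first. -/
def cyclesWord (d : List (List ℕ)) : List ℕ :=
  (d.map fun c => cycleWord (c.headD 0) c.tail).flatten

theorem cyclesWord_cons (s : ℕ) (l : List ℕ) (d : List (List ℕ)) :
    cyclesWord ((s :: l) :: d) = cycleWord s l ++ cyclesWord d := by simp [cyclesWord]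

theorem AreCycles.tail {n : ℕ} {c : List ℕ} {d : List (List ℕ)} (h : AreCycles n (c :: d)) :
    AreCycles n d := fun c' hc' => h c' (List.mem_cons_of_mem _ hc')

theorem natPerm_reverse_cyclesWord {n : ℕ} {d : List (List ℕ)} (hd : AreCycles n d) :
    natPerm (cyclesWord d).reverse = cyclesProd d.reverse := by
  induction d with
  | nil => simp [cyclesWord]
  | cons c d ih =>
    obtain ⟨hne, hnd, -⟩ := hd c List.mem_cons_self
    obtain ⟨s, l, rfl⟩ := List.exists_cons_of_ne_nil hne
    rw [cyclesWord_cons, List.reverse_append, natPerm_append, ih hd.tail,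
      natPerm_reverse_cycleWord hnd, List.reverse_cons, cyclesProd_append]
    simp

theorem cyclesWord_bounds {n : ℕ} {d : List (List ℕ)} (hd : AreCycles n d) :
    IsWord n (cyclesWord d) ∧ (cyclesWord d).length ≤ d.flatten.length * (2 * n) := by
  induction d with
  | nil => simp [cyclesWord, IsWord]
  | cons c d ih =>
    obtain ⟨hne, hnd, hr⟩ := hd c List.mem_cons_self
    obtain ⟨s, l, rfl⟩ := List.exists_cons_of_ne_nil hne
    obtain ⟨h₁, h₂⟩ := ih hd.tail
    obtain ⟨h₃, h₄⟩ := cycleWord_bounds (hr s List.mem_cons_self)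
      fun x hx => hr x (List.mem_cons_of_mem _ hx)
    refine ⟨cyclesWord_cons s l d ▸ isWord_append h₃ h₁, ?_⟩
    simp only [cyclesWord_cons, List.flatten_cons, List.length_append, List.length_cons, add_mul]
    omega

theorem computes_subFLoop (w : List ℕ) {n : ℕ} {d : List (List ℕ)} (hd : AreCycles n d) :
    Computes (subFLoop w d) (w ++ cyclesWord d) (d.flatten.length * (6 * n + 8) + 1) := by
  induction d generalizing w with
  | nil => simpa [subFLoop, cyclesWord] using Computes.op w
  | cons c d ih =>
    obtain ⟨hne, hnd, hr⟩ := hd c List.mem_cons_self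
    obtain ⟨s, l, rfl⟩ := List.exists_cons_of_ne_nil hne
    have h₁ := computes_subFCycle w (hr s List.mem_cons_self)
      fun x hx => hr x (List.mem_cons_of_mem _ hx)
    have h₂ := ih (w ++ cycleWord s l) hd.tail
    rw [List.append_assoc, ← cyclesWord_cons] at h₂
    refine .mono (Computes.tick_bind (Computes.op_bind (h₁.bind h₂))) ?_
    simp only [List.flatten_cons, List.length_append, List.length_cons, add_mul]
    omega

/-- The cycle that is written first is applied first, so the cycles multiply in reverse order. -/
theorem computes_subF {n : ℕ} {d : List (List ℕ)} (hd : AreCycles n d) :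
    ∃ x, Computes (subF d) x (d.flatten.length * (10 * n + 8) + 4) ∧ IsWord n x ∧
      x.length ≤ d.flatten.length * (2 * n) ∧ natPerm x = cyclesProd d.reverse := by
  obtain ⟨h₁, h₂⟩ := cyclesWord_bounds hd
  have h := computes_subFLoop [] hd
  have hrev := computes_rev (cyclesWord d) []
  rw [List.nil_append] at h
  rw [List.append_nil] at hrev
  refine ⟨_, .mono (Computes.tick_bind (Computes.op_bind (h.bind hrev))) ?_,
    fun i hi => h₁ i (List.mem_reverse.1 hi), by simpa using h₂, natPerm_reverse_cyclesWord hd⟩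
  nlinarith

/-! ### Permutations of `Fin n` as permutations of `{1, …, n}` -/

/-- The element `p - 1` of `Fin n` stands for the point `p`. -/
def point (n : ℕ) : Fin n ↪ ℕ := ⟨fun p => p + 1, fun p q h => Fin.ext (by simpa using h)⟩

theorem mem_range_point {n x : ℕ} (hx : 1 ≤ x ∧ x ≤ n) : ∃ p, point n p = x :=
  ⟨⟨x - 1, by omega⟩, Nat.sub_add_cancel hx.1⟩

/-- The permutation of `{1, …, n}` that corresponds to a permutation of `Fin n`. -/
noncomputable abbrev toNat (n : ℕ) : Perm (Fin n) →* Perm ℕ := Perm.viaEmbeddingHom (point n)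

theorem toNat_injective (n : ℕ) : Function.Injective (toNat n) :=
  Perm.viaEmbeddingHom_injective _

theorem toNat_swap {n : ℕ} (p q : Fin n) : toNat n (swap p q) = swap (point n p) (point n q) := by
  ext x
  by_cases hx : x ∈ Set.range (point n)
  · obtain ⟨r, rfl⟩ := hx
    rw [Perm.viaEmbeddingHom_apply, Perm.viaEmbedding_apply, (point n).injective.swap_apply]
  · rw [Perm.viaEmbeddingHom_apply, Perm.viaEmbedding_apply_of_notMem _ _ _ hx,
      Equiv.swap_apply_of_ne_of_ne] <;> rintro rfl <;> exact hx ⟨_, rfl⟩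

theorem toNat_wordPerm {n : ℕ} {w : List ℕ} (hw : IsWord n w) :
    toNat n (wordPerm n w) = natPerm w := by
  induction w with
  | nil => simp [wordPerm]
  | cons i w ih =>
    have hi := hw i List.mem_cons_self
    have h := ih fun j hj => hw j (List.mem_cons_of_mem _ hj)
    have hgen : toNat n (gen n i) = swap i (i + 1) := by
      rw [gen, dif_pos hi, toNat_swap]
      congr 1
      exact Nat.sub_add_cancel hi.1
    rw [natPerm_cons, ← h, ← hgen, ← map_mul]
    simp [wordPerm]

/-- The sign is not defined on permutations of `ℕ`; it is that of the corresponding permutation of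
`Fin n`. -/
theorem exists_sign_formPerm {n s : ℕ} {l : List ℕ} (hnd : (s :: l).Nodup)
    (hr : ∀ x ∈ s :: l, 1 ≤ x ∧ x ≤ n) :
    ∃ τ : Perm (Fin n), toNat n τ = (s :: l).formPerm ∧ Perm.sign τ = (-1) ^ l.length := by
  induction l generalizing s with
  | nil => exact ⟨1, by simp⟩
  | cons e l ih =>
    obtain ⟨τ, hτ, hsign⟩ := ih (s := e) (List.nodup_cons.1 hnd).2
      fun x hx => hr x (List.mem_cons_of_mem _ hx)
    obtain ⟨p, rfl⟩ := mem_range_point (hr s (by simp))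
    obtain ⟨q, rfl⟩ := mem_range_point (hr e (by simp))
    have hpq : p ≠ q := fun h' => by simp [h'] at hnd
    refine ⟨swap p q * τ, ?_, ?_⟩
    · rw [map_mul, hτ, toNat_swap, List.formPerm_cons_cons]
    · rw [Perm.sign_mul, Perm.sign_swap hpq, hsign, List.length_cons, pow_succ']

theorem exists_sign_cyclesProd {n : ℕ} {d : List (List ℕ)} (hd : AreCycles n d) :
    ∃ τ : Perm (Fin n), toNat n τ = cyclesProd d ∧
      Perm.sign τ = (-1) ^ (d.flatten.length + d.length) := by
  induction d with
  | nil => exact ⟨1, by simp⟩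
  | cons c d ih =>
    obtain ⟨hne, hnd, hr⟩ := hd c List.mem_cons_self
    obtain ⟨s, l, rfl⟩ := List.exists_cons_of_ne_nil hne
    obtain ⟨τ, hτ, hsign⟩ := ih hd.tail
    obtain ⟨ρ, hρ, hsign'⟩ := exists_sign_formPerm hnd hr
    refine ⟨ρ * τ, by rw [map_mul, hτ, hρ, cyclesProd_cons], ?_⟩
    rw [Perm.sign_mul, hsign, hsign', ← pow_add]
    simp only [List.flatten_cons, List.length_append, List.length_cons]
    rw [show l.length + 1 + d.flatten.length + (d.length + 1) =
      l.length + (d.flatten.length + d.length) + 2 by ring, pow_add _ _ 2]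
    simp

theorem IsDecomp.isEvenDecomp {n : ℕ} (hn : 1 ≤ n) {σ : Perm (Fin n)}
    (hσ : σ ∈ alternatingGroup (Fin n)) {d : List (List ℕ)} (h : IsDecomp n (toNat n σ) d)
    (hσn : toNat n σ ∈ permsUpTo n) : IsEvenDecomp d where
  ne_nil := by
    rintro rfl
    have := h.length_flatten
    simp at this
    omega
  cycles := fun c hc => (h.orbits c hc).1
  nodup := h.nodup
  even := by
    obtain ⟨τ, hτ, hsign⟩ := exists_sign_cyclesProd h.areCycles
    rw [h.cyclesProd_eq hσn] at hτ
    rw [toNat_injective n hτ, Perm.mem_alternatingGroup.1 hσ] at hsign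
    by_contra hodd
    rw [Nat.not_even_iff_odd] at hodd
    rw [hodd.neg_one_pow] at hsign
    exact absurd hsign (by decide)

/-! ### The algorithm -/

/-- The factors from subalgorithm C, rewritten as single cycles by subalgorithms E and B. -/
theorem IsFactor.exists_cycle {n : ℕ} (hn : 1 ≤ n) {D : List ℕ} (hD : D.Nodup)
    (hm : ∀ x, x ∈ D ↔ 1 ≤ x ∧ x ≤ n) {c : List (List ℕ)} (hc : IsFactor D c) :
    ∃ C, C.Nodup ∧ (∀ x, x ∈ C ↔ 1 ≤ x ∧ x ≤ n) ∧ C.formPerm = cyclesProd c ∧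
      Computes (subE n c) (table n (cyclesProd c)) (30 * n ^ 2) ∧
      Computes (subB n (table n (cyclesProd c))) [C] (30 * n ^ 2) := by
  have hlen : D.length = n := by simpa using (perm_range' hD hm).length_eq
  have hcyc : AreCycles n c := fun p hp =>
    ⟨(hc.cycles p hp).1, (hc.cycles p hp).2.1, fun x hx => (hm x).1 ((hc.cycles p hp).2.2 x hx)⟩
  obtain ⟨e, he, hce⟩ := hc.cycle
  have hsq := Nat.le_self_pow two_ne_zero n
  have h₁ := hc.length_lt
  have h₂ := hc.length_flatten
  obtain ⟨d, hB, hd⟩ := computes_subB hn (cyclesProd_mem hcyc)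
  rw [hce] at hd
  obtain ⟨C, rfl, hCe, hCn, hCm⟩ := hd.eq_singleton hn (he.nodup_iff.2 hD)
    fun x => he.mem_iff.trans (hm x)
  refine ⟨C, hCn, hCm, hCe.trans hce.symm, (computes_subE hcyc).mono ?_, hB.mono ?_⟩
  · rw [hlen] at h₁ h₂
    nlinarith
  · nlinarith

/-- The output represents `σ = C₁ C₂` with `C₂ = τ C₁⁻¹ τ⁻¹` as the commutator of `C₁` and `τ`,
and it is found in time `O(n ^ 2 + n k)` for an input of length `k`. -/
theorem exists_runs_cejtinRivin {n : ℕ} (hn : 1 ≤ n) {w : List ℕ} (hw : IsEvenWord n w) :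
    ∃ s t, Runs (cejtinRivin n w) s t ∧ IsCommutatorString n (wordPerm n w) s ∧
      t ≤ 1000 * (n ^ 2 + n * w.length) := by
  obtain ⟨hw, heven⟩ := hw
  have hσ := natPerm_mem hw
  obtain ⟨d, hB, hd⟩ := computes_subB hn hσ
  have hd' : IsEvenDecomp d := by
    rw [← toNat_wordPerm hw] at hd hσ
    exact hd.isEvenDecomp hn heven hσ
  obtain ⟨c₁, c₂, hC, hf₁, hf₂, hprod⟩ := subCFactors hd'
  rw [hd.length_flatten] at hC
  rw [hd.cyclesProd_eq hσ] at hprod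
  obtain ⟨C₁, hnd₁, hm₁, hC₁, hE₁, hB₁⟩ := hf₁.exists_cycle hn hd.nodup hd.mem
  obtain ⟨C₂, hnd₂, hm₂, hC₂, hE₂, hB₂⟩ := hf₂.exists_cycle hn hd.nodup hd.mem
  have hlen₁ : C₁.length = n := by simpa using (perm_range' hnd₁ hm₁).length_eq
  have hlen₂ : C₂.length = n := by simpa using (perm_range' hnd₂ hm₂).length_eq
  have hnd₃ : C₁.reverse.Nodup := List.nodup_reverse.2 hnd₁
  have hm₃ : ∀ x, x ∈ C₁.reverse ↔ 1 ≤ x ∧ x ≤ n := fun x => List.mem_reverse.trans (hm₁ x)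
  obtain ⟨τ, hτ, hfix⟩ := exists_perm_map hnd₃ hnd₂ (by simp [hlen₁, hlen₂])
  have hτn : τ ∈ permsUpTo n := fun x hx => hfix x (mt (hm₃ x).1 hx) (mt (hm₂ x).1 hx)
  obtain ⟨dτ, hD, hdτ⟩ := computes_subD hn hτn hnd₃ hm₃
  rw [hτ] at hD
  have hcyc : ∀ {C : List ℕ}, C.Nodup → (∀ x, x ∈ C ↔ 1 ≤ x ∧ x ≤ n) → AreCycles n [C] := by
    intro C hC hm c hc
    obtain rfl := List.mem_singleton.1 hc
    refine ⟨?_, hC, fun x => (hm x).1⟩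
    rintro rfl
    simpa using (hm 1).2 ⟨le_rfl, hn⟩
  obtain ⟨x, hFx, hxw, hxl, hx⟩ := computes_subF (hcyc hnd₁ hm₁)
  obtain ⟨y, hFy, hyw, hyl, hy⟩ := computes_subF hdτ.areCycles
  obtain ⟨x', hFx', hxw', hxl', hx'⟩ := computes_subF (hcyc hnd₃ hm₃)
  have hyw' : IsWord n y.reverse := fun i hi => hyw i (List.mem_reverse.1 hi)
  rw [hdτ.reverse.cyclesProd_eq hτn] at hy
  simp only [List.reverse_singleton, cyclesProd_cons, cyclesProd_nil, mul_one,
    List.flatten_singleton, List.length_reverse, List.formPerm_reverse, hlen₁,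
    hdτ.length_flatten] at hFx hxl hx hFy hyl hFx' hxl' hx'
  have hrev₁ := computes_rev C₁ []
  have hrev₂ := computes_rev y []
  rw [List.append_nil] at hrev₁ hrev₂
  have hrun : Computes (cejtinRivin n w)
      (x ++ [0] ++ y ++ [0] ++ x' ++ [0] ++ y.reverse ++ [0, 0]) _ :=
    (computes_copy w).bind ((computes_subA hw).bind (hB.bind (hC.bind (hE₁.bind (hE₂.bind
      (hB₁.bind (hB₂.bind (Computes.op_bind (Computes.op_bind (hrev₁.bind (hD.bind (hFx.bind
      (hFy.bind (hFx'.bind (hrev₂.bind (computes_copy _))))))))))))))))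
  obtain ⟨t, ht, hruns⟩ := hrun.runs
  refine ⟨_, t, hruns, ⟨x, y, x', y.reverse, rfl, hxw, hyw, hxw', hyw', ?_, ?_, ?_⟩, ht.trans ?_⟩
  · apply toNat_injective n
    rw [map_inv, toNat_wordPerm hxw', toNat_wordPerm hxw, hx', hx]
  · apply toNat_injective n
    rw [map_inv, toNat_wordPerm hyw', toNat_wordPerm hyw, natPerm_reverse]
  · apply toNat_injective n
    rw [map_mul, map_mul, map_mul, map_inv, map_inv, toNat_wordPerm hw, toNat_wordPerm hxw,
      toNat_wordPerm hyw, hx, hy, ← hprod, ← hC₁, ← hC₂, ← hτ, formPerm_map,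
      List.formPerm_reverse]
    simp only [mul_assoc]
  · have hsq := Nat.le_self_pow two_ne_zero n
    have hk := Nat.le_mul_of_pos_left w.length hn
    simp only [List.length_append, List.length_cons, List.length_nil, List.length_reverse, hlen₁]
    nlinarith

end CejtinRivin

theorem mainTheorem2 :
    -- correctness: the algorithm terminates and writes the input as a simple commutator
    (∀ n : ℕ, 1 ≤ n → ∀ w : List ℕ, CejtinRivin.IsEvenWord n w →
      ∃ (s : List ℕ) (t : ℕ), CejtinRivin.Runs (CejtinRivin.cejtinRivin n w) s t ∧
        CejtinRivin.IsCommutatorString n (CejtinRivin.wordPerm n w) s) ∧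
    -- time `O(n ^ 2)` for input words of fixed length `k`
    (∀ k : ℕ, ∃ c n₀ : ℕ, ∀ n : ℕ, n₀ < n → ∀ w : List ℕ, w.length = k →
      CejtinRivin.IsEvenWord n w →
      ∃ (s : List ℕ) (t : ℕ), CejtinRivin.Runs (CejtinRivin.cejtinRivin n w) s t ∧
        t ≤ c * n ^ 2) ∧
    -- time `O(k)` for fixed `n`
    (∀ n : ℕ, 1 ≤ n → ∃ c k₀ : ℕ, ∀ k : ℕ, k₀ < k → ∀ w : List ℕ, w.length = k →
      CejtinRivin.IsEvenWord n w →
      ∃ (s : List ℕ) (t : ℕ), CejtinRivin.Runs (CejtinRivin.cejtinRivin n w) s t ∧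
        t ≤ c * k) := by
  refine ⟨fun n hn w hw => ?_, fun k => ⟨1000 * (1 + k), 0, fun n hn w hk hw => ?_⟩,
    fun n hn => ⟨1000 * (n ^ 2 + n), 0, fun k hk₀ w hk hw => ?_⟩⟩
  · obtain ⟨s, t, hrun, hs, -⟩ := CejtinRivin.exists_runs_cejtinRivin hn hw
    exact ⟨s, t, hrun, hs⟩
  · obtain ⟨s, t, hrun, -, ht⟩ := CejtinRivin.exists_runs_cejtinRivin hn hw
    refine ⟨s, t, hrun, ht.trans ?_⟩
    rw [hk, mul_assoc, add_mul, one_mul, mul_comm n k]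
    have := Nat.mul_le_mul_left k (Nat.le_self_pow two_ne_zero n)
    omega
  · obtain ⟨s, t, hrun, -, ht⟩ := CejtinRivin.exists_runs_cejtinRivin hn hw
    refine ⟨s, t, hrun, ht.trans ?_⟩
    rw [hk, mul_assoc, add_mul]
    have := Nat.le_mul_of_pos_right (n ^ 2) hk₀
    omega
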